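/- **Setting.** For $f\in L^1(\mathbb R^d)$ let $\widehat f(\omega)=\int_{\mathbb R^d} f(x)e^{-2\pi i\langle x,\omega\rangle}\,dx$, extended to $L^2(\mathbb R^d)$ as usual. For $s>0$ let $H^s(\mathbb R^d)$ be the space of $f\in L^2(\mathbb R^d)$ with $\|f\|_{H^s}:=\big(\int|\widehat f(\omega)|^2(1+|\omega|^2)^s\,d\omega\big)^{1/2}<\infty$. A module-sequence $\Omega$ consists, for every $n\ge 1$, of filters $\chi_n$ and $g_{\lambda_n}$, $\lambda_n\in\Lambda_n$ ($\Lambda_n$ countable), in $L^1(\mathbb R^d)\cap L^2(\mathbb R^d)$. It is Parseval if $\|f*\chi_n\|_2^2+\sum_{\lambda_n\in\Lambda_n}\|f*g_{\lambda_n}\|_2^2=\|f\|_2^2$ for all $n\ge 1$ and $f\in L^2(\mathbb R^d)$. For $q=(\lambda_1,\dots,\lambda_n)\in\Lambda^n:=\Lambda_1\times\dots\times\Lambda_n$ put $U[q]f:=|\,\cdots|\,|f*g_{\lambda_1}|*g_{\lambda_2}|\cdots*g_{\lambda_n}|$, with $U[\emptyset]f:=f$ for $n=0$, and let $|||\Phi^n_\Omega(f)|||^2:=\sum_{q\in\Lambda^n}\|(U[q]f)*\chi_{n+1}\|_2^2$.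 For $\varepsilon\in(0,1)$, $N\in\{0,1,2,\dots\}$ and $f\ne 0$ consider $$(1-\varepsilon)\le\frac{\sum_{n=0}^N|||\Phi_\Omega^n(f)|||^2}{\|f\|_2^2}\le 1.\qquad(*)$$ Let $\gamma:=\min\{1,2s\}$, and let $\alpha:=1$ if $d=1$ and $\alpha:=\log_2\sqrt{d/(d-1/2)}$ if $d\ge 2$. **Corollary.** (i) Let $d\ge1$, $\delta>0$, and let $\Omega$ be a Parseval module-sequence on $\mathbb R^d$ such that every $\widehat{g_{\lambda_n}}$ is supported in a rotated orthant $\{Ax : x_k\ge 0,\ k=1,\dots,d\}$ for some $A\in O(d)$ (depending on $\lambda_n$), and, for every $n$, $\sum_{\lambda_n\in\Lambda_n}|\widehat{g_{\lambda_n}}(\omega)|^2=0$ for a.e. $\omega$ with $|\omega|<\delta$. Let $l>\lfloor d/2\rfloor+1$ be real, $\varepsilon\in(0,1)$, $s>0$ and $f\in H^s(\mathbb R^d)\setminus\{0\}$. If $$N\ge\Bigg\lceil\Bigg(\frac{2l\,\|f\|_{H^s}^{2/\gamma}}{\varepsilon^{1/\gamma}\,\delta\,\|f\|_2^{2/\gamma}}\Bigg)^{1/\alpha}-1\Bigg\rceil,$$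 then $(*)$ holds. (ii) Let $d=1$, $l>1$ real, $\varepsilon\in(0,1)$, $s>0$ and $f\in H^s(\mathbb R)\setminus\{0\}$. In each of the following two cases, if $$N\ge\Bigg\lceil\log_a\Bigg(\frac{2l\,\|f\|_{H^s}^{2/\gamma}}{\varepsilon^{1/\gamma}\,\delta\,\|f\|_2^{2/\gamma}}\Bigg)\Bigg\rceil,$$ then $(*)$ holds. * Wavelets, with $a=5/3$ and $\delta=1$: $\psi,\phi\in L^1(\mathbb R)\cap L^2(\mathbb R)$ satisfy $\operatorname{supp}\widehat\psi\subseteq[1/2,2]$ and $|\widehat\phi(\omega)|^2+\sum_{j\ge1}|\widehat\psi(2^{-j}\omega)|^2=1$ for a.e. $\omega\ge0$; in every layer $\chi=\phi$, $g_j(x)=2^j\psi(2^jx)$ for $j\ge1$ and $g_j(x)=2^{|j|}\psi(-2^{|j|}x)$ for $j\le-1$ (index set $\mathbb Z\setminus\{0\}$); and the resulting module-sequence $\Omega$ is Parseval. * Weyl–Heisenberg filters, with $a=3/2$ and $\delta=R$, where $R>0$: $g,\phi\in L^1(\mathbb R)\cap L^2(\mathbb R)$ satisfy $\operatorname{supp}\widehat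 g\subseteq[-R,R]$, $\widehat g(-\omega)=\widehat g(\omega)$ for all $\omega\in\mathbb R$, and $|\widehat\phi(\omega)|^2+\sum_{k\ge1}|\widehat g(\omega-R(k+1))|^2=1$ for a.e. $\omega\ge0$; in every layer $\chi=\phi$, $g_k(x)=e^{2\pi i(k+1)Rx}g(x)$ for $k\ge1$ and $g_k(x)=e^{-2\pi i(|k|+1)Rx}g(x)$ for $k\le-1$ (index set $\mathbb Z\setminus\{0\}$); and the resulting module-sequence $\Omega$ is Parseval. -/

import Mathlib

open MeasureTheory FourierTransform
open scoped ENNReal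

universe u v

noncomputable section

/-- The data of a module-sequence `Ω = ((Ψ_n, |·|, Id))_{n ≥ 1}` on signals `E → ℂ`: for every
layer, an output-generating filter and a countable family of filters. Layers are numbered from `0`,
so `Λ n`, `χ n`, `g n` are the index set and the filters of `Ψ_{n+1}`: `g n` leads from layer `n`
to layer `n + 1` of the network and `χ n` generates the output of layer `n`. -/
structure ModuleSequence (E : Type v) where
  Λ : ℕ → Type u
  countable_Λ : ∀ n, Countable (Λ n)
  χ : ℕ → E → ℂ
  g : (n : ℕ) → Λ n → E → ℂ

section General

variable {E : Type v} [NormedAddCommGroup E] [InnerProductSpace ℝ E] [FiniteDimensional ℝ E]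
  [MeasurableSpace E] [BorelSpace E]

/-- The space `L¹ ∩ L²` of Lebesgue-measurable functions. -/
def MemL1L2 (f : E → ℂ) : Prop :=
  MemLp f 1 volume ∧ MemLp f 2 volume

/-- The convolution `(f ∗ g)(y) = ∫ f(x) g(y - x) dx`. -/
def conv (f g : E → ℂ) : E → ℂ :=
  convolution f g (ContinuousLinearMap.mul ℂ ℂ) volume

/-- The squared `L²`-norm `‖f‖₂²`, as an extended nonnegative real. -/
def energy (f : E → ℂ) : ℝ≥0∞ :=
  eLpNorm f 2 volume ^ 2

/-- The squared Sobolev norm `∫ |f̂(ω)|² (1 + |ω|²)^s dω` of `f ∈ L²`, with `f̂` the `L²` Fourier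
transform. -/
def sobolevEnergy (s : ℝ) (f : Lp (α := E) ℂ 2 volume) : ℝ≥0∞ :=
  ∫⁻ ω, ‖(𝓕 f : Lp (α := E) ℂ 2 volume) ω‖ₑ ^ 2 * ENNReal.ofReal ((1 + ‖ω‖ ^ 2) ^ s) ∂volume

/-- `f ∈ H^s`. -/
def MemHs (s : ℝ) (f : Lp (α := E) ℂ 2 volume) : Prop :=
  sobolevEnergy s f < ∞

/-- The Sobolev norm `‖f‖_{H^s}` of `f ∈ H^s`. -/
def sobolevNorm (s : ℝ) (f : Lp (α := E) ℂ 2 volume) : ℝ :=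
  √(sobolevEnergy s f).toReal

namespace ModuleSequence

/-- All filters lie in `L¹ ∩ L²`. -/
def FiltersMemL1L2 (Ω : ModuleSequence.{u} E) : Prop :=
  ∀ n, MemL1L2 (Ω.χ n) ∧ ∀ j, MemL1L2 (Ω.g n j)

/-- In every layer the filters satisfy the frame condition
`A_n ‖f‖₂² ≤ ‖f ∗ χ_n‖₂² + ∑_λ ‖f ∗ g_λ‖₂² ≤ B_n ‖f‖₂²` for all `f ∈ L²`. -/
def HasFrameBounds (Ω : ModuleSequence.{u} E) (A B : ℕ → ℝ) : Prop :=
  ∀ n, 0 < A n ∧ 0 < B n ∧ ∀ f : E → ℂ, MemLp f 2 volume →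
    ENNReal.ofReal (A n) * energy f
        ≤ energy (conv f (Ω.χ n)) + ∑' j : Ω.Λ n, energy (conv f (Ω.g n j)) ∧
      energy (conv f (Ω.χ n)) + ∑' j : Ω.Λ n, energy (conv f (Ω.g n j))
        ≤ ENNReal.ofReal (B n) * energy f

/-- The filters of every layer form a Parseval frame. -/
def IsParseval (Ω : ModuleSequence.{u} E) : Prop :=
  Ω.HasFrameBounds (fun _ => 1) (fun _ => 1)

/-- Paths of length `n`, i.e. the elements of `Λ^n = Λ_1 × ⋯ × Λ_n`. -/
def Path (Ω : ModuleSequence.{u} E) (n : ℕ) : Type u :=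
  (i : Fin n) → Ω.Λ i

/-- The feature map `U[q] f`: `U[∅] f = f` and `U[(q, λ)] f = |(U[q] f) ∗ g_λ|`. -/
def U (Ω : ModuleSequence.{u} E) : (n : ℕ) → Ω.Path n → (E → ℂ) → E → ℂ
  | 0, _, f => f
  | n + 1, q, f => fun x =>
      ((‖conv (Ω.U n (fun i => q i.castSucc) f) (Ω.g n (q (Fin.last n))) x‖ : ℝ) : ℂ)

/-- `|||Φ_Ω^n(f)|||² = ∑_{q ∈ Λ^n} ‖(U[q] f) ∗ χ_{n+1}‖₂²`, the energy of the features generated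
in layer `n`. -/
def featureEnergy (Ω : ModuleSequence.{u} E) (n : ℕ) (f : E → ℂ) : ℝ≥0∞ :=
  ∑' q : Ω.Path n, energy (conv (Ω.U n q f) (Ω.χ n))

/-- `1 - ε ≤ (∑_{n=0}^N |||Φ_Ω^n(f)|||²) / ‖f‖₂² ≤ 1`. -/
def CapturesEnergy (Ω : ModuleSequence.{u} E) (ε : ℝ) (N : ℕ) (f : E → ℂ) : Prop :=
  ENNReal.ofReal (1 - ε) ≤ (∑ n ∈ Finset.range (N + 1), Ω.featureEnergy n f) / energy f ∧
    (∑ n ∈ Finset.range (N + 1), Ω.featureEnergy n f) / energy f ≤ 1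

end ModuleSequence

end General

/-- The rotated orthant `H_A = {A x : x_k ≥ 0 for all k}`, `A ∈ O(d)`. -/
def rotatedOrthant {d : ℕ} (A : Matrix.orthogonalGroup (Fin d) ℝ) :
    Set (EuclideanSpace ℝ (Fin d)) :=
  {ω | ∃ x : EuclideanSpace ℝ (Fin d), (∀ k, 0 ≤ x k) ∧
    ω = Matrix.toEuclideanLin (A : Matrix (Fin d) (Fin d) ℝ) x}

/-- The filters `g_λ` are analytic (each Fourier transform is supported in a rotated orthant) and
leave the spectral gap `B_δ(0)` in every layer. -/
structure ModuleSequence.AnalyticHighPass {d : ℕ}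
    (Ω : ModuleSequence.{u} (EuclideanSpace ℝ (Fin d))) (δ : ℝ) : Prop where
  analytic : ∀ (n : ℕ) (j : Ω.Λ n), ∃ A : Matrix.orthogonalGroup (Fin d) ℝ,
    tsupport (𝓕 (Ω.g n j)) ⊆ rotatedOrthant A
  gap : ∀ n : ℕ, ∀ᵐ ω ∂(volume : Measure (EuclideanSpace ℝ (Fin d))),
    ω ∈ Metric.ball (0 : EuclideanSpace ℝ (Fin d)) δ →
      ∑' j : Ω.Λ n, ‖𝓕 (Ω.g n j) ω‖ₑ ^ 2 = 0

/-- The exponent `α`: `1` for `d = 1` and `log₂ √(d / (d - 1/2))` for `d ≥ 2`. -/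
def decayExponent (d : ℕ) : ℝ :=
  if d = 1 then 1 else Real.logb 2 (√((d : ℝ) / ((d : ℝ) - 1 / 2)))

/-- The conditions on the mother wavelet `ψ` and the father wavelet `φ`. -/
structure IsWaveletPair (ψ φ : ℝ → ℂ) : Prop where
  memψ : MemL1L2 ψ
  memφ : MemL1L2 φ
  supp : tsupport (𝓕 ψ) ⊆ Set.Icc (1 / 2) 2
  littlewoodPaley : ∀ᵐ ω ∂(volume : Measure ℝ), 0 ≤ ω →
    ‖𝓕 φ ω‖ₑ ^ 2 + ∑' j : ℕ, ‖𝓕 ψ (((2 : ℝ) ^ (j + 1))⁻¹ * ω)‖ₑ ^ 2 = 1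

/-- The wavelet module-sequence: in every layer `χ = φ`, `g_j(x) = 2^j ψ(2^j x)` for `j ≥ 1` and
`g_j(x) = 2^|j| ψ(-2^|j| x)` for `j ≤ -1`. -/
def waveletModule (ψ φ : ℝ → ℂ) : ModuleSequence.{0} ℝ where
  Λ _ := {j : ℤ // j ≠ 0}
  countable_Λ _ := inferInstance
  χ _ := φ
  g _ j := fun x =>
    if 0 < j.1 then 2 ^ j.1.natAbs * ψ (2 ^ j.1.natAbs * x)
    else 2 ^ j.1.natAbs * ψ (-(2 ^ j.1.natAbs * x))

/-- The conditions on the Weyl-Heisenberg prototype function `g` and the low-pass filter `φ`. -/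
structure IsWeylHeisenbergPair (R : ℝ) (g φ : ℝ → ℂ) : Prop where
  memg : MemL1L2 g
  memφ : MemL1L2 φ
  supp : tsupport (𝓕 g) ⊆ Set.Icc (-R) R
  symm : ∀ ω : ℝ, 𝓕 g (-ω) = 𝓕 g ω
  littlewoodPaley : ∀ᵐ ω ∂(volume : Measure ℝ), 0 ≤ ω →
    ‖𝓕 φ ω‖ₑ ^ 2 + ∑' k : ℕ, ‖𝓕 g (ω - R * (((k + 1 : ℕ) : ℝ) + 1))‖ₑ ^ 2 = 1

/-- The Weyl-Heisenberg module-sequence: in every layer `χ = φ`,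
`g_k(x) = e^{2πi(k+1)Rx} g(x)` for `k ≥ 1` and `g_k(x) = e^{-2πi(|k|+1)Rx} g(x)` for `k ≤ -1`. -/
def weylHeisenbergModule (R : ℝ) (g φ : ℝ → ℂ) : ModuleSequence.{0} ℝ where
  Λ _ := {k : ℤ // k ≠ 0}
  countable_Λ _ := inferInstance
  χ _ := φ
  g _ k := fun x =>
    if 0 < k.1 then
      Complex.exp (2 * Real.pi * Complex.I * ((k.1.natAbs : ℂ) + 1) * R * x) * g x
    else Complex.exp (-(2 * Real.pi * Complex.I * ((k.1.natAbs : ℂ) + 1) * R * x)) * g x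

/-- The quantity `2 l ‖f‖_{H^s}^{2/γ} / (ε^{1/γ} δ ‖f‖₂^{2/γ})` with `γ = min {1, 2s}`, which
controls the number of layers needed. -/
def layerRatio {E : Type*} [NormedAddCommGroup E] [InnerProductSpace ℝ E] [FiniteDimensional ℝ E]
    [MeasurableSpace E] [BorelSpace E] (l s ε δ : ℝ) (f : Lp (α := E) ℂ 2 volume) : ℝ :=
  (2 * l * sobolevNorm s f ^ (2 / min 1 (2 * s))) /
    (ε ^ (1 / min 1 (2 * s)) * δ * ‖f‖ ^ (2 / min 1 (2 * s)))

end

/-! By Parseval, the feature energies of layers `0, …, N` and the energy `W` of all `U[q] f` with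
`q` of length `N + 1` add up to `‖f‖₂²`. The upper bound is then immediate, and the lower one
amounts to `W ≤ ε ‖f‖₂²`.

`W` is controlled by weighted spectral energies. The weights are `w_0 = 1` and `w_{j+1} = 1 -
r_{T_j}`, where `r_T(ω)` is the share of a ball of diameter `T` covered by its translate by `ω`.
Being an autocorrelation, `r_T` is the Fourier transform of a kernel `K ≥ 0`, so `|⟨h, h ∗
(modulated K)⟩| ≤ ⟨|h|, |h| ∗ K⟩`: the modulus captures at least as much energy under `r_T` as `h`
does under any translate of `r_T`. The total energy is unchanged, so the energy of `|h|` under `w_j`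
is at most that of `h` under `w_j(· - ν)`, for every `ν`. If `h = f ∗ g_λ` and `ν` is such that
`w_j(ω - ν) ≤ w_{j+1}(ω)` wherever `ĝ_λ(ω) ≠ 0` (`Demodulates`), Parseval allows summation over `λ`,
and one layer trades `w_j` for `w_{j+1}` (`tsum_weightedEnergy_le`). After `N + 1` layers, `W ≤ ∫
|f̂|² (1 - r_{T_N})`.

Finally `1 - r_T(ω) ≤ d |ω| / T`, which interpolates to `(2l/T)^γ (1 + |ω|²)^s`; hence `T_N ≥
layerRatio * δ` suffices. A filter family enters only through its admissible radii: `(j+1)^α δ` for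
orthants, `(5/3)^j` for wavelets, `(3/2)^j R` for Weyl–Heisenberg filters. -/

noncomputable section

/-! ### The `L²` Fourier transform and convolution with `L¹ ∩ L²` filters. -/

section L2Fourier

variable {E : Type v} [NormedAddCommGroup E] [InnerProductSpace ℝ E] [FiniteDimensional ℝ E]
  [MeasurableSpace E] [BorelSpace E]

theorem integral_fourier_mul_eq_flip {f g : E → ℂ} (hf : Integrable f) (hg : Integrable g) :
    ∫ ξ, 𝓕 f ξ * g ξ = ∫ x, f x * 𝓕 g x := by
  simpa using! VectorFourier.integral_fourierIntegral_smul_eq_flip (L := innerₗ E)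
    Real.continuous_fourierChar continuous_inner hf hg

theorem integral_fourierInv_mul_eq_flip {f g : E → ℂ} (hf : Integrable f) (hg : Integrable g) :
    ∫ ξ, 𝓕⁻ f ξ * g ξ = ∫ x, f x * 𝓕⁻ g x := by
  have h := integral_fourier_mul_eq_flip hf hg.comp_neg
  calc ∫ ξ, 𝓕⁻ f ξ * g ξ = ∫ ξ, 𝓕⁻ f (-ξ) * g (-ξ) :=
        (integral_neg_eq_self (fun ξ => 𝓕⁻ f ξ * g ξ) volume).symm
    _ = ∫ ξ, 𝓕 f ξ * g (-ξ) := by simp_rw [Real.fourierInv_eq_fourier_neg, neg_neg]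
    _ = ∫ x, f x * 𝓕 (fun y => g (-y)) x := h
    _ = _ := by simp_rw [Real.fourierInv_eq_fourier_comp_neg]

theorem norm_fourier_le_integral_norm (f : E → ℂ) (ξ : E) : ‖𝓕 f ξ‖ ≤ ∫ x, ‖f x‖ :=
  VectorFourier.norm_fourierIntegral_le_integral_norm _ _ _ _ _

theorem continuous_fourier {f : E → ℂ} (hf : Integrable f) : Continuous (𝓕 f) :=
  VectorFourier.fourierIntegral_continuous Real.continuous_fourierChar continuous_inner hf

theorem continuous_fourierInv {f : E → ℂ} (hf : Integrable f) : Continuous (𝓕⁻ f) := by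
  have : 𝓕⁻ f = fun x => 𝓕 f (-x) := funext fun x => Real.fourierInv_eq_fourier_neg f x
  rw [this]
  exact (continuous_fourier hf).comp continuous_neg

/-- Both sides agree against every smooth compactly supported function: each transform can be moved
onto the test function, one by its distributional description, the other by the flip formula for
integrals. -/
theorem fourier_toLp_ae_eq {u : E → ℂ} (h1 : MemLp u 1) (h2 : MemLp u 2) :
    (𝓕 (h2.toLp u) : Lp (α := E) ℂ 2 volume) =ᵐ[volume] 𝓕 u := by
  have hu : Integrable u := memLp_one_iff_integrable.1 h1
  refine ae_eq_of_integral_contDiff_smul_eq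
    ((Lp.memLp _).locallyIntegrable (by norm_num)) (continuous_fourier hu).locallyIntegrable ?_
  intro g g_smooth g_cpt
  have hg₁ : HasCompactSupport (Complex.ofRealCLM ∘ g) := g_cpt.comp_left rfl
  have hg₂ := Complex.ofRealCLM.contDiff.comp g_smooth
  set G := hg₁.toSchwartzMap hg₂ with hG
  have key := congrArg (fun T => T G) (Lp.fourier_toTemperedDistribution_eq (h2.toLp u))
  simp only [TemperedDistribution.fourier_apply, Lp.toTemperedDistribution_apply] at key
  have hGg : ∀ x, G x = (g x : ℂ) := fun x => by simp [hG]
  calc ∫ x, g x • (𝓕 (h2.toLp u) : Lp (α := E) ℂ 2 volume) x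
      = ∫ x, G x • (𝓕 (h2.toLp u) : Lp (α := E) ℂ 2 volume) x := by simp [hGg]
    _ = ∫ x, (𝓕 G) x • (h2.toLp u) x := key.symm
    _ = ∫ x, u x * 𝓕 (G : E → ℂ) x := by
        refine integral_congr_ae ?_
        filter_upwards [h2.coeFn_toLp] with x hx
        rw [hx, smul_eq_mul, mul_comm, SchwartzMap.fourier_coe]
    _ = ∫ x, 𝓕 u x * G x := (integral_fourier_mul_eq_flip hu G.integrable).symm
    _ = ∫ x, g x • 𝓕 u x := by simp [hGg, mul_comm]

theorem fourierInv_toLp_ae_eq {u : E → ℂ} (h1 : MemLp u 1) (h2 : MemLp u 2) :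
    (𝓕⁻ (h2.toLp u) : Lp (α := E) ℂ 2 volume) =ᵐ[volume] 𝓕⁻ u := by
  have hu : Integrable u := memLp_one_iff_integrable.1 h1
  refine ae_eq_of_integral_contDiff_smul_eq
    ((Lp.memLp _).locallyIntegrable (by norm_num)) (continuous_fourierInv hu).locallyIntegrable ?_
  intro g g_smooth g_cpt
  have hg₁ : HasCompactSupport (Complex.ofRealCLM ∘ g) := g_cpt.comp_left rfl
  have hg₂ := Complex.ofRealCLM.contDiff.comp g_smooth
  set G := hg₁.toSchwartzMap hg₂ with hG
  have key := congrArg (fun T => T G) (Lp.fourierInv_toTemperedDistribution_eq (h2.toLp u))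
  simp only [TemperedDistribution.fourierInv_apply, Lp.toTemperedDistribution_apply] at key
  have hGg : ∀ x, G x = (g x : ℂ) := fun x => by simp [hG]
  calc ∫ x, g x • (𝓕⁻ (h2.toLp u) : Lp (α := E) ℂ 2 volume) x
      = ∫ x, G x • (𝓕⁻ (h2.toLp u) : Lp (α := E) ℂ 2 volume) x := by simp [hGg]
    _ = ∫ x, (𝓕⁻ G) x • (h2.toLp u) x := key.symm
    _ = ∫ x, u x * 𝓕⁻ (G : E → ℂ) x := by
        refine integral_congr_ae ?_
        filter_upwards [h2.coeFn_toLp] with x hx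
        rw [hx, smul_eq_mul, mul_comm, SchwartzMap.fourierInv_coe]
    _ = ∫ x, 𝓕⁻ u x * G x := (integral_fourierInv_mul_eq_flip hu G.integrable).symm
    _ = ∫ x, g x • 𝓕⁻ u x := by simp [hGg, mul_comm]

open Classical in
/-- The `L²` Fourier transform of a square integrable function, as a function. -/
def fourierL2 (f : E → ℂ) : E → ℂ :=
  if h : MemLp f 2 volume then (𝓕 (h.toLp f) : Lp (α := E) ℂ 2 volume) else 0

theorem fourierL2_of_memLp {f : E → ℂ} (h : MemLp f 2 volume) :
    fourierL2 f = (𝓕 (h.toLp f) : Lp (α := E) ℂ 2 volume) := dif_pos h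

theorem memLp_fourierL2 (f : E → ℂ) : MemLp (fourierL2 f) 2 volume := by
  by_cases h : MemLp f 2 volume
  · rw [fourierL2_of_memLp h]
    exact Lp.memLp _
  · simp [fourierL2, h]

theorem fourierL2_coe (f : Lp (α := E) ℂ 2 volume) :
    fourierL2 f = (𝓕 f : Lp (α := E) ℂ 2 volume) := by
  rw [fourierL2_of_memLp (Lp.memLp f), Lp.toLp_coeFn]

theorem fourierL2_ae_eq_fourier {f : E → ℂ} (hf : MemL1L2 f) : fourierL2 f =ᵐ[volume] 𝓕 f := by
  rw [fourierL2_of_memLp hf.2]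
  exact fourier_toLp_ae_eq hf.1 hf.2

theorem eLpNorm_fourierL2 {f : E → ℂ} (hf : MemLp f 2 volume) :
    eLpNorm (fourierL2 f) 2 volume = eLpNorm f 2 volume := by
  rw [fourierL2_of_memLp hf, ← Lp.enorm_def, ← ofReal_norm, Lp.norm_fourier_eq, ofReal_norm,
    Lp.enorm_def]
  exact eLpNorm_congr_ae hf.coeFn_toLp

theorem integral_conj_mul_fourierL2 {f g : E → ℂ} (hf : MemLp f 2 volume) (hg : MemLp g 2 volume) :
    ∫ ω, starRingEnd ℂ (fourierL2 f ω) * fourierL2 g ω = ∫ x, starRingEnd ℂ (f x) * g x := by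
  have h := Lp.inner_fourier_eq (hf.toLp f) (hg.toLp g)
  rw [L2.inner_def, L2.inner_def, ← fourierL2_of_memLp hf, ← fourierL2_of_memLp hg] at h
  simp only [RCLike.inner_apply'] at h
  rw [h]
  refine integral_congr_ae ?_
  filter_upwards [hf.coeFn_toLp, hg.coeFn_toLp] with x h1 h2
  rw [h1, h2]

theorem energy_eq_lintegral (f : E → ℂ) : energy f = ∫⁻ x, ‖f x‖ₑ ^ 2 := by
  rw [energy, eLpNorm_eq_lintegral_rpow_enorm_toReal (by norm_num) (by norm_num),
    ← ENNReal.rpow_natCast, ← ENNReal.rpow_mul]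
  norm_num

theorem energy_eq_lintegral_fourierL2 {f : E → ℂ} (hf : MemLp f 2 volume) :
    energy f = ∫⁻ ω, ‖fourierL2 f ω‖ₑ ^ 2 := by
  rw [← energy_eq_lintegral, energy, energy, eLpNorm_fourierL2 hf]

theorem energy_lt_top {f : E → ℂ} (hf : MemLp f 2 volume) : energy f < ∞ :=
  ENNReal.pow_lt_top hf.2

theorem memLp_mul_fourier {u g : E → ℂ} (hu : MemLp u 2 volume) (hg : MemL1L2 g) :
    MemL1L2 (fun ω => u ω * 𝓕 g ω) := by
  have hgi : Integrable g := memLp_one_iff_integrable.1 hg.1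
  have hgf : MemLp (𝓕 g) 2 volume :=
    (memLp_congr_ae (fourierL2_ae_eq_fourier hg)).1 (memLp_fourierL2 g)
  refine ⟨?_, ?_⟩
  · exact hgf.mul (r := 1) hu
  · have hb : MemLp (𝓕 g) ∞ volume := memLp_top_of_bound
      (continuous_fourier hgi).aestronglyMeasurable (∫ x, ‖g x‖)
      (Filter.Eventually.of_forall (norm_fourier_le_integral_norm g))
    exact hb.mul (r := 2) hu

theorem memL1L2_conj_comp_sub_left {g : E → ℂ} (hg : MemL1L2 g) (y : E) :
    MemL1L2 (fun x => starRingEnd ℂ (g (y - x))) := by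
  have hm : MeasurePreserving (fun x : E => y - x) volume volume :=
    Measure.measurePreserving_sub_left volume y
  exact ⟨(hg.1.comp_measurePreserving hm).star, (hg.2.comp_measurePreserving hm).star⟩

theorem fourier_conj_comp_sub_left (g : E → ℂ) (y ω : E) :
    𝓕 (fun x => starRingEnd ℂ (g (y - x))) ω
      = starRingEnd ℂ ((Real.fourierChar (inner ℝ ω y) : ℂ) * 𝓕 g ω) := by
  rw [Real.fourier_eq, Real.fourier_eq, ← integral_const_mul, ← integral_conj,
    ← integral_sub_left_eq_self _ volume y]
  refine integral_congr_ae (Filter.Eventually.of_forall fun x => ?_)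
  simp only [Circle.smul_def, smul_eq_mul, map_mul, sub_sub_cancel, ← Circle.coe_inv_eq_conj,
    ← AddChar.map_neg_eq_inv, neg_neg]
  rw [← mul_assoc, ← Circle.coe_mul, ← AddChar.map_add_eq_mul, inner_sub_left,
    real_inner_comm ω y]
  congr 3
  ring_nf

/-- This is Plancherel for `f` and `x ↦ conj (g (y - x))`; it gives equality at every `y`, not only
almost everywhere. -/
theorem conv_eq_fourierInv {f g : E → ℂ} (hf : MemLp f 2 volume) (hg : MemL1L2 g) :
    conv f g = 𝓕⁻ (fun ω => fourierL2 f ω * 𝓕 g ω) := by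
  ext y
  have hk := memL1L2_conj_comp_sub_left hg y
  have h := integral_conj_mul_fourierL2 hk.2 hf
  simp only [Complex.conj_conj] at h
  calc conv f g y = ∫ x, g (y - x) * f x := by
        simp only [conv, convolution_def, ContinuousLinearMap.mul_apply']
        exact integral_congr_ae (Filter.Eventually.of_forall fun x => mul_comm _ _)
    _ = _ := h.symm
    _ = _ := by
        rw [Real.fourierInv_eq]
        refine integral_congr_ae ?_
        filter_upwards [fourierL2_ae_eq_fourier hk] with ω hω
        rw [hω, fourier_conj_comp_sub_left, Complex.conj_conj, Circle.smul_def, smul_eq_mul]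
        ring

theorem memLp_conv {f g : E → ℂ} (hf : MemLp f 2 volume) (hg : MemL1L2 g) :
    MemLp (conv f g) 2 volume := by
  have h := memLp_mul_fourier (memLp_fourierL2 f) hg
  rw [conv_eq_fourierInv hf hg]
  exact (memLp_congr_ae (fourierInv_toLp_ae_eq h.1 h.2)).1 (Lp.memLp _)

theorem fourierL2_conv {f g : E → ℂ} (hf : MemLp f 2 volume) (hg : MemL1L2 g) :
    fourierL2 (conv f g) =ᵐ[volume] fun ω => fourierL2 f ω * 𝓕 g ω := by
  have h := memLp_mul_fourier (memLp_fourierL2 f) hg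
  have hc := memLp_conv hf hg
  have e : hc.toLp (conv f g) = 𝓕⁻ (h.2.toLp _) := by
    refine Lp.ext ?_
    filter_upwards [hc.coeFn_toLp, fourierInv_toLp_ae_eq h.1 h.2] with x h1 h2
    rw [h1, h2, conv_eq_fourierInv hf hg]
  rw [fourierL2_of_memLp hc, e, fourier_fourierInv_eq]
  exact h.2.coeFn_toLp

theorem energy_conv {f g : E → ℂ} (hf : MemLp f 2 volume) (hg : MemL1L2 g) :
    energy (conv f g) = ∫⁻ ω, ‖fourierL2 f ω‖ₑ ^ 2 * ‖𝓕 g ω‖ₑ ^ 2 := by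
  rw [energy_eq_lintegral_fourierL2 (memLp_conv hf hg)]
  refine lintegral_congr_ae ?_
  filter_upwards [fourierL2_conv hf hg] with ω hω
  rw [hω, enorm_mul, mul_pow]

/-- Every square integrable function is the `L²` Fourier transform of a square integrable
function. -/
theorem exists_fourierL2_eq {u : E → ℂ} (hu : MemLp u 2 volume) :
    ∃ f : E → ℂ, MemLp f 2 volume ∧ fourierL2 f =ᵐ[volume] u := by
  refine ⟨(𝓕⁻ (hu.toLp u) : Lp (α := E) ℂ 2 volume), Lp.memLp _, ?_⟩
  rw [fourierL2_coe, fourier_fourierInv_eq]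
  exact hu.coeFn_toLp

end L2Fourier

/-! ### The modulus against nonnegative kernels. -/

section Demodulation

/-- The modulation of `K` by the frequency `ν`. -/
def modulate {E : Type v} [NormedAddCommGroup E] [InnerProductSpace ℝ E] (ν : E) (K : E → ℂ) : E → ℂ := fun x => (Real.fourierChar (inner ℝ x ν) : ℂ) * K x

theorem norm_modulate {E : Type v} [NormedAddCommGroup E] [InnerProductSpace ℝ E] (ν : E) (K : E → ℂ) (x : E) : ‖modulate ν K x‖ = ‖K x‖ := by
  rw [modulate, norm_mul, Circle.norm_coe, one_mul]

variable {E : Type v} [NormedAddCommGroup E] [InnerProductSpace ℝ E] [FiniteDimensional ℝ E]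
  [MeasurableSpace E] [BorelSpace E]

theorem memL1L2_modulate {K : E → ℂ} (hK : MemL1L2 K) (ν : E) : MemL1L2 (modulate ν K) := by
  have hc : Continuous fun x : E => (Real.fourierChar (inner ℝ x ν) : ℂ) :=
    continuous_subtype_val.comp (Real.continuous_fourierChar.comp (by fun_prop))
  have hm : AEStronglyMeasurable (modulate ν K) volume :=
    hc.aestronglyMeasurable.mul hK.1.1
  have hn : ∀ᵐ x ∂(volume : Measure E), ‖modulate ν K x‖ = ‖K x‖ :=
    Filter.Eventually.of_forall (norm_modulate ν K)
  exact ⟨(memLp_congr_norm hm hK.1.1 hn).2 hK.1, (memLp_congr_norm hm hK.1.1 hn).2 hK.2⟩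

theorem fourier_modulate (ν : E) (K : E → ℂ) (ω : E) : 𝓕 (modulate ν K) ω = 𝓕 K (ω - ν) := by
  rw [Real.fourier_eq, Real.fourier_eq]
  refine integral_congr_ae (Filter.Eventually.of_forall fun x => ?_)
  simp only [modulate, Circle.smul_def, smul_eq_mul]
  rw [← mul_assoc, ← Circle.coe_mul, ← AddChar.map_add_eq_mul, inner_sub_right]
  congr 3
  ring_nf

theorem memLp_norm_ofReal {h : E → ℂ} (hh : MemLp h 2 volume) :
    MemLp (fun x => ((‖h x‖ : ℝ) : ℂ)) 2 volume := hh.norm.ofReal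

theorem energy_norm_ofReal (h : E → ℂ) : energy (fun x => ((‖h x‖ : ℝ) : ℂ)) = energy h := by
  simp [energy_eq_lintegral, ← ofReal_norm]

/-- By Plancherel the integral on the right is itself the nonnegative spectral integral. Written as
a norm, it is open to the triangle inequality. -/
theorem lintegral_fourierL2_mul_eq_enorm_integral {f K : E → ℂ} {m : E → ℝ}
    (hf : MemLp f 2 volume) (hK : MemL1L2 K) (hm0 : ∀ ω, 0 ≤ m ω)
    (hm : ∀ ω, 𝓕 K ω = m ω) :
    ∫⁻ ω, ‖fourierL2 f ω‖ₑ ^ 2 * ENNReal.ofReal (m ω)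
      = ‖∫ x, starRingEnd ℂ (f x) * conv f K x‖ₑ := by
  have e1 : ∫ x, starRingEnd ℂ (f x) * conv f K x
      = ((∫ ω, ‖fourierL2 f ω‖ ^ 2 * m ω : ℝ) : ℂ) := by
    rw [← integral_conj_mul_fourierL2 hf (memLp_conv hf hK), ← integral_complex_ofReal]
    refine integral_congr_ae ?_
    filter_upwards [fourierL2_conv hf hK] with ω hω
    rw [hω, hm, ← mul_assoc, mul_comm (starRingEnd ℂ _), Complex.mul_conj, Complex.normSq_eq_norm_sq]
    push_cast
    rfl
  have hKi : Integrable K := memLp_one_iff_integrable.1 hK.1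
  have hmm : m = fun ω => (𝓕 K ω).re := by
    ext ω
    simp [hm]
  have hint : Integrable (fun ω => ‖fourierL2 f ω‖ ^ 2 * m ω) := by
    refine Integrable.mul_bdd (c := ∫ x, ‖K x‖) (memLp_fourierL2 f).norm.integrable_sq ?_ ?_
    · rw [hmm]
      exact (Complex.continuous_re.comp (continuous_fourier hKi)).aestronglyMeasurable
    · refine Filter.Eventually.of_forall fun ω => ?_
      have := norm_fourier_le_integral_norm K ω
      rw [hm] at this
      simpa using this
  have hpos : ∀ ω, 0 ≤ ‖fourierL2 f ω‖ ^ 2 * m ω := fun ω => mul_nonneg (sq_nonneg _) (hm0 ω)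
  rw [e1, ← ofReal_norm, Complex.norm_real, Real.norm_of_nonneg (integral_nonneg hpos),
    ofReal_integral_eq_lintegral_ofReal hint (Filter.Eventually.of_forall hpos)]
  refine lintegral_congr fun ω => ?_
  rw [ENNReal.ofReal_mul (sq_nonneg _), ENNReal.ofReal_pow (norm_nonneg _), ofReal_norm]

/-- The modulation factor has absolute value one, so it disappears once the absolute value is taken
inside the integral. -/
theorem norm_conv_modulate_le {h K : E → ℂ} (hK : ∀ x, K x = (‖K x‖ : ℝ)) (ν x : E) :
    ‖conv h (modulate ν K) x‖ ≤ ‖conv (fun x => ((‖h x‖ : ℝ) : ℂ)) K x‖ := by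
  have e : conv (fun x => ((‖h x‖ : ℝ) : ℂ)) K x
      = ((∫ t, ‖h t * modulate ν K (x - t)‖ : ℝ) : ℂ) := by
    rw [← integral_complex_ofReal]
    simp only [conv, convolution_def, ContinuousLinearMap.mul_apply']
    refine integral_congr_ae (Filter.Eventually.of_forall fun t => ?_)
    simp only [norm_mul, norm_modulate]
    rw [hK (x - t)]
    simp
  rw [e, Complex.norm_real, Real.norm_of_nonneg (integral_nonneg fun t => norm_nonneg _)]
  simp only [conv, convolution_def, ContinuousLinearMap.mul_apply']
  exact norm_integral_le_integral_norm _

theorem conv_norm_eq_norm {h K : E → ℂ} (hK : ∀ x, K x = (‖K x‖ : ℝ)) (x : E) :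
    conv (fun x => ((‖h x‖ : ℝ) : ℂ)) K x
      = (‖conv (fun x => ((‖h x‖ : ℝ) : ℂ)) K x‖ : ℝ) := by
  have e : conv (fun x => ((‖h x‖ : ℝ) : ℂ)) K x
      = ((∫ t, ‖h t‖ * ‖K (x - t)‖ : ℝ) : ℂ) := by
    rw [← integral_complex_ofReal]
    simp only [conv, convolution_def, ContinuousLinearMap.mul_apply']
    refine integral_congr_ae (Filter.Eventually.of_forall fun t => ?_)
    simp only
    rw [hK (x - t)]
    simp
  rw [e, Complex.norm_real, Real.norm_of_nonneg (integral_nonneg fun t => by positivity)]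

/-- The modulus moves energy towards the spectral regions in which the Fourier transform of a
nonnegative kernel is large, at least as much as any demodulation does. -/
theorem lintegral_fourierL2_mul_sub_le {h K : E → ℂ} {m : E → ℝ}
    (hh : MemLp h 2 volume) (hK : MemL1L2 K) (hK0 : ∀ x, K x = (‖K x‖ : ℝ))
    (hm0 : ∀ ω, 0 ≤ m ω) (hm : ∀ ω, 𝓕 K ω = m ω) (ν : E) :
    ∫⁻ ω, ‖fourierL2 h ω‖ₑ ^ 2 * ENNReal.ofReal (m (ω - ν))
      ≤ ∫⁻ ω, ‖fourierL2 (fun x => ((‖h x‖ : ℝ) : ℂ)) ω‖ₑ ^ 2 * ENNReal.ofReal (m ω) := by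
  have hh' := memLp_norm_ofReal hh
  rw [lintegral_fourierL2_mul_eq_enorm_integral hh (memL1L2_modulate hK ν) (fun ω => hm0 (ω - ν))
      (fun ω => by rw [fourier_modulate, hm]),
    lintegral_fourierL2_mul_eq_enorm_integral hh' hK hm0 hm]
  have hint : Integrable fun x => ‖h x‖ * ‖conv (fun x => ((‖h x‖ : ℝ) : ℂ)) K x‖ :=
    (memLp_conv hh' hK).norm.integrable_mul (p := 2) (q := 2) hh.norm |>.congr
      (Filter.Eventually.of_forall fun x => mul_comm _ _)
  have e : ∫ x, starRingEnd ℂ ((‖h x‖ : ℝ) : ℂ) * conv (fun x => ((‖h x‖ : ℝ) : ℂ)) K x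
      = ((∫ x, ‖h x‖ * ‖conv (fun x => ((‖h x‖ : ℝ) : ℂ)) K x‖ : ℝ) : ℂ) := by
    rw [← integral_complex_ofReal]
    refine integral_congr_ae (Filter.Eventually.of_forall fun x => ?_)
    simp only [Complex.conj_ofReal]
    rw [conv_norm_eq_norm hK0 x]
    simp
  rw [e, enorm_le_iff_norm_le, Complex.norm_real,
    Real.norm_of_nonneg (integral_nonneg fun t => by positivity)]
  refine norm_integral_le_of_norm_le hint (Filter.Eventually.of_forall fun x => ?_)
  rw [norm_mul, RCLike.norm_conj]
  exact mul_le_mul_of_nonneg_left (norm_conv_modulate_le hK0 ν x) (norm_nonneg _)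

end Demodulation

/-! ### The overlap of a ball with its translates. -/

section BallOverlap

variable {E : Type v} [NormedAddCommGroup E] [InnerProductSpace ℝ E] [FiniteDimensional ℝ E]
  [MeasurableSpace E] [BorelSpace E]

open Metric
open scoped Pointwise

/-- The proportion of a ball of diameter `T` that is covered by its translate by `ω`. -/
def ballOverlap (T : ℝ) (ω : E) : ℝ :=
  volume.real (ball (0 : E) (T / 2) ∩ ball ω (T / 2)) / volume.real (ball (0 : E) (T / 2))

theorem ballOverlap_nonneg (T : ℝ) (ω : E) : 0 ≤ ballOverlap T ω := by
  unfold ballOverlap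
  positivity

theorem ballOverlap_le_one (T : ℝ) (ω : E) : ballOverlap T ω ≤ 1 :=
  div_le_one_of_le₀ (measureReal_mono Set.inter_subset_left measure_ball_lt_top.ne) (by positivity)

theorem ballOverlap_eq_zero {T : ℝ} {ω : E} (h : T ≤ ‖ω‖) : ballOverlap T ω = 0 := by
  have : ball (0 : E) (T / 2) ∩ ball ω (T / 2) = ∅ := by
    refine (ball_disjoint_ball ?_).inter_eq
    rw [dist_zero_left]
    linarith
  simp [ballOverlap, this]

theorem measureReal_ball_pos {T : ℝ} (hT : 0 < T) : 0 < volume.real (ball (0 : E) T) :=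
  ENNReal.toReal_pos (measure_ball_pos _ _ hT).ne' measure_ball_lt_top.ne

theorem ballOverlap_smul {T : ℝ} (hT : 0 < T) (ω : E) :
    ballOverlap T (T • ω) = ballOverlap 1 ω := by
  have hb : ∀ x : E, ball (T • x) (T / 2) = T • ball x (1 / 2) := fun x => by
    rw [_root_.smul_ball hT.ne', Real.norm_of_nonneg hT.le]
    congr 1
    ring
  have hb0 : ball (0 : E) (T / 2) = T • ball (0 : E) (1 / 2) := by simpa using hb 0
  have hp : (0 : ℝ) < |T ^ Module.finrank ℝ E| := by positivity
  unfold ballOverlap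
  rw [hb, hb0, ← Set.smul_set_inter₀ hT.ne', measureReal_def, measureReal_def,
    Measure.addHaar_smul, Measure.addHaar_smul, ENNReal.toReal_mul, ENNReal.toReal_mul,
    ENNReal.toReal_ofReal hp.le, mul_div_mul_left _ _ hp.ne']
  rfl

/-- The reflection that exchanges `x` and `y` preserves volume and the ball around `0`. -/
theorem ballOverlap_eq_of_norm_eq (T : ℝ) {x y : E} (h : ‖x‖ = ‖y‖) :
    ballOverlap T x = ballOverlap T y := by
  set Φ : E ≃ₗᵢ[ℝ] E := (ℝ ∙ (x - y))ᗮ.reflection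
  have hΦ : Φ x = y := Submodule.reflection_sub h
  have hpre : Φ ⁻¹' (ball (0 : E) (T / 2) ∩ ball y (T / 2))
      = ball (0 : E) (T / 2) ∩ ball x (T / 2) := by
    rw [Set.preimage_inter, ← hΦ, LinearIsometryEquiv.preimage_ball,
      LinearIsometryEquiv.preimage_ball]
    simp
  unfold ballOverlap
  rw [← hpre, measureReal_def, Φ.measurePreserving.measure_preimage
    (measurableSet_ball.inter measurableSet_ball).nullMeasurableSet]
  rfl

/-- With the two centres placed symmetrically, monotonicity along rays becomes a plain inclusion of
intersections. -/
theorem measureReal_ball_inter_ball (ω : E) (r : ℝ) :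
    volume.real (ball (0 : E) r ∩ ball ω r)
      = volume.real (ball (-((1 / 2 : ℝ) • ω)) r ∩ ball ((1 / 2 : ℝ) • ω) r) := by
  have hpre : (fun x => x + (1 / 2 : ℝ) • ω) ⁻¹' (ball (0 : E) r ∩ ball ω r)
      = ball (-((1 / 2 : ℝ) • ω)) r ∩ ball ((1 / 2 : ℝ) • ω) r := by
    ext x
    simp only [Set.mem_preimage, Set.mem_inter_iff, mem_ball, dist_eq_norm, sub_neg_eq_add,
      sub_zero]
    have : x + (1 / 2 : ℝ) • ω - ω = x - (1 / 2 : ℝ) • ω := by module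
    rw [this]
  rw [← hpre, measureReal_def, measureReal_def, measure_preimage_add_right]

theorem ballOverlap_smul_le {T t : ℝ} (h0 : 0 ≤ t) (h1 : t ≤ 1) (ω : E) :
    ballOverlap T ω ≤ ballOverlap T (t • ω) := by
  unfold ballOverlap
  refine div_le_div_of_nonneg_right ?_ (by positivity)
  rw [measureReal_ball_inter_ball, measureReal_ball_inter_ball]
  refine measureReal_mono ?_ (measure_inter_lt_top_of_left_ne_top measure_ball_lt_top.ne).ne
  -- The point `x - t • v` lies on the segment from `x - v` to `x + v`, and balls are convex.
  have key : ∀ x v : E, ‖x - v‖ < T / 2 → ‖x + v‖ < T / 2 → ‖x - t • v‖ < T / 2 := by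
    intro x v hx hy
    have hc := (convex_ball (0 : E) (T / 2)) (mem_ball_zero_iff.2 hx) (mem_ball_zero_iff.2 hy)
      (show 0 ≤ (1 + t) / 2 by linarith) (show 0 ≤ (1 - t) / 2 by linarith) (by ring)
    rw [mem_ball_zero_iff] at hc
    rwa [show x - t • v = ((1 + t) / 2) • (x - v) + ((1 - t) / 2) • (x + v) by module]
  rintro x ⟨hx, hy⟩
  simp only [mem_ball, dist_eq_norm, sub_neg_eq_add] at hx hy
  have a := key x _ hy hx
  have b := key x (-((1 / 2 : ℝ) • ω)) (by simpa using hx) (by simpa [← sub_eq_add_neg] using hy)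
  refine ⟨?_, ?_⟩
  · rw [mem_ball, dist_eq_norm]
    rwa [show x - -((1 / 2 : ℝ) • t • ω) = x - t • -((1 / 2 : ℝ) • ω) by module]
  · rw [mem_ball, dist_eq_norm]
    rwa [show x - (1 / 2 : ℝ) • t • ω = x - t • (1 / 2 : ℝ) • ω by module]

theorem ballOverlap_anti {T : ℝ} {x y : E} (h : ‖x‖ ≤ ‖y‖) : ballOverlap T y ≤ ballOverlap T x := by
  rcases eq_or_ne y 0 with rfl | hy
  · have : x = 0 := by simpa using h
    rw [this]
  · have hy' : 0 < ‖y‖ := norm_pos_iff.2 hy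
    refine (ballOverlap_smul_le (t := ‖x‖ / ‖y‖) (by positivity) ((div_le_one hy').2 h) y).trans ?_
    refine (ballOverlap_eq_of_norm_eq T ?_).le
    rw [norm_smul, Real.norm_of_nonneg (by positivity), div_mul_cancel₀ _ hy'.ne']

/-- The overlap depends only on the ratio of `‖ω‖` to the diameter and decreases in it. -/
theorem ballOverlap_le_ballOverlap {S T : ℝ} (hS : 0 < S) (hT : 0 < T) {x y : E}
    (h : ‖x‖ * T ≤ ‖y‖ * S) : ballOverlap T y ≤ ballOverlap S x := by
  have hx : ballOverlap S x = ballOverlap 1 (S⁻¹ • x) := by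
    rw [← ballOverlap_smul hS, smul_inv_smul₀ hS.ne']
  have hy : ballOverlap T y = ballOverlap 1 (T⁻¹ • y) := by
    rw [← ballOverlap_smul hT, smul_inv_smul₀ hT.ne']
  rw [hx, hy]
  refine ballOverlap_anti ?_
  rw [norm_smul, norm_smul, Real.norm_of_nonneg (by positivity), Real.norm_of_nonneg (by positivity),
    inv_mul_le_iff₀ hS, ← mul_assoc, mul_comm S, mul_assoc, mul_comm S, ← div_eq_inv_mul,
    le_div_iff₀ hT]
  exact h

/-- With `t = ‖ω‖ / T < 1`, the ball of radius `(1 - t) T / 2` around `ω / 2` fits into the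
intersection; its share of the volume is `(1 - t)^d`, and Bernoulli's inequality applies. -/
theorem one_sub_mul_le_ballOverlap {T : ℝ} (hT : 0 < T) (ω : E) :
    1 - Module.finrank ℝ E * (‖ω‖ / T) ≤ ballOverlap T ω := by
  have hd : (0 : ℝ) ≤ Module.finrank ℝ E := by positivity
  rcases le_or_gt T ‖ω‖ with h | h
  · rw [ballOverlap_eq_zero h]
    have h1 : 1 ≤ ‖ω‖ / T := (one_le_div hT).2 h
    rcases Nat.eq_zero_or_pos (Module.finrank ℝ E) with h0 | h0
    · have : Subsingleton E := Module.finrank_zero_iff.1 h0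
      rw [Subsingleton.elim ω 0, norm_zero] at h
      exact absurd h (not_le.2 hT)
    · have : (1 : ℝ) ≤ Module.finrank ℝ E := by exact_mod_cast h0
      nlinarith
  · set t := ‖ω‖ / T
    have ht1 : t < 1 := (div_lt_one hT).2 h
    have hr : 0 < 1 - t := by linarith
    have hsub : ball ((1 / 2 : ℝ) • ω) ((1 - t) * (T / 2))
        ⊆ ball (0 : E) (T / 2) ∩ ball ω (T / 2) := by
      have hω : ‖ω‖ = t * T := (div_mul_cancel₀ _ hT.ne').symm
      refine Set.subset_inter (ball_subset_ball' ?_) (ball_subset_ball' ?_)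
      · rw [dist_zero_right, norm_smul, hω]
        norm_num
        linarith
      · have : (1 / 2 : ℝ) • ω - ω = -((1 / 2 : ℝ) • ω) := by module
        rw [dist_eq_norm, this, norm_neg, norm_smul, hω]
        norm_num
        linarith
    have hvol : volume.real (ball ((1 / 2 : ℝ) • ω) ((1 - t) * (T / 2)))
        = (1 - t) ^ Module.finrank ℝ E * volume.real (ball (0 : E) (T / 2)) := by
      rw [measureReal_def, Measure.addHaar_ball_mul_of_pos _ _ hr, ENNReal.toReal_mul,
        ENNReal.toReal_ofReal (by positivity)]
      rfl
    calc 1 - Module.finrank ℝ E * t ≤ (1 - t) ^ Module.finrank ℝ E := by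
          have := one_add_mul_le_pow (a := -t) (by linarith) (Module.finrank ℝ E)
          simpa [← sub_eq_add_neg] using this
      _ ≤ _ := by
          unfold ballOverlap
          rw [le_div_iff₀ (measureReal_ball_pos (by positivity)), ← hvol]
          exact measureReal_mono hsub (measure_inter_lt_top_of_left_ne_top measure_ball_lt_top.ne).ne

/-- The overlap function is the Fourier transform of a nonnegative kernel. -/
theorem exists_kernel_ballOverlap {T : ℝ} (hT : 0 < T) :
    ∃ K : E → ℂ, MemL1L2 K ∧ (∀ x, K x = (‖K x‖ : ℝ)) ∧ ∀ ω, 𝓕 K ω = ballOverlap T ω := by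
  set u : E → ℂ := (ball (0 : E) (T / 2)).indicator fun _ => 1 with hu
  have hmeas : MeasurableSet (ball (0 : E) (T / 2)) := measurableSet_ball
  have huL : MemL1L2 u :=
    ⟨memLp_indicator_const _ hmeas _ (Or.inr measure_ball_lt_top.ne),
      memLp_indicator_const _ hmeas _ (Or.inr measure_ball_lt_top.ne)⟩
  set V := volume.real (ball (0 : E) (T / 2)) with hV
  have hV0 : 0 < V := measureReal_ball_pos (by positivity)
  have hFu : MemLp (𝓕 u) 2 volume :=
    (memLp_congr_ae (fourierL2_ae_eq_fourier huL)).1 (memLp_fourierL2 u)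
  have hsq := memLp_mul_fourier hFu huL
  -- The ball is symmetric about `0`, so `𝓕 u` is real and its square is nonnegative.
  have hreal : ∀ ω, 𝓕 u ω = ((𝓕 u ω).re : ℂ) := by
    intro ω
    have h := fourier_conj_comp_sub_left u 0 ω
    have hsymm : (fun x => starRingEnd ℂ (u (0 - x))) = u := by
      ext x
      simp only [hu, Set.indicator, zero_sub, mem_ball_zero_iff, norm_neg]
      split_ifs <;> simp
    rw [hsymm, inner_zero_right, AddChar.map_zero_eq_one, Circle.coe_one, one_mul] at h
    exact (Complex.conj_eq_iff_re.1 h.symm).symm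
  have hconv : ∀ y, conv u u y = (volume.real (ball (0 : E) (T / 2) ∩ ball y (T / 2)) : ℝ) := by
    intro y
    have : (fun t => u t * u (y - t))
        = (ball (0 : E) (T / 2) ∩ ball y (T / 2)).indicator fun _ => (1 : ℂ) := by
      ext t
      simp only [hu, Set.indicator, Set.mem_inter_iff, mem_ball, dist_eq_norm, sub_zero,
        norm_sub_rev t y]
      split_ifs <;> simp_all
    simp only [conv, convolution_def, ContinuousLinearMap.mul_apply', this]
    rw [integral_indicator_const _ (hmeas.inter measurableSet_ball)]
    simp
  refine ⟨fun ω => (V⁻¹ : ℂ) * (𝓕 u ω * 𝓕 u ω), ⟨hsq.1.const_mul _, hsq.2.const_mul _⟩, ?_, ?_⟩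
  · intro ω
    simp only
    rw [hreal ω]
    norm_cast
    rw [Real.norm_of_nonneg (mul_nonneg (by positivity) (mul_self_nonneg _))]
  · intro ω
    have hn : ballOverlap T ω = ballOverlap T (-ω) := ballOverlap_eq_of_norm_eq T (norm_neg ω).symm
    -- The convolution formula for `u` with itself already contains the Fourier inversion needed for
    -- the kernel.
    have hinv : 𝓕⁻ (fun ω => 𝓕 u ω * 𝓕 u ω) (-ω) = conv u u (-ω) := by
      rw [conv_eq_fourierInv huL.2 huL]
      refine Real.fourierInv_congr_ae ?_ _
      filter_upwards [fourierL2_ae_eq_fourier huL] with x hx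
      rw [hx]
    rw [Real.fourierInv_eq_fourier_neg, neg_neg, hconv] at hinv
    rw [hn, ballOverlap, Complex.ofReal_div, ← hinv, Real.fourier_eq, Real.fourier_eq,
      div_eq_inv_mul, ← integral_const_mul]
    refine integral_congr_ae (Filter.Eventually.of_forall fun x => ?_)
    simp only [Circle.smul_def, smul_eq_mul]
    ring

end BallOverlap

/-! ### Propagation of weighted energies through the network. -/

section Network

variable {E : Type v} [NormedAddCommGroup E] [InnerProductSpace ℝ E] [FiniteDimensional ℝ E]
  [MeasurableSpace E] [BorelSpace E]

/-- The energy of `f` after weighting its spectrum with `w`. -/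
def weightedEnergy (w : E → ℝ) (f : E → ℂ) : ℝ≥0∞ :=
  ∫⁻ ω, ‖fourierL2 f ω‖ₑ ^ 2 * ENNReal.ofReal (w ω)

theorem weightedEnergy_one {f : E → ℂ} (hf : MemLp f 2 volume) :
    weightedEnergy (fun _ => 1) f = energy f := by
  simp [weightedEnergy, energy_eq_lintegral_fourierL2 hf]

theorem continuous_ballOverlap {T : ℝ} (hT : 0 < T) : Continuous (ballOverlap T : E → ℝ) := by
  obtain ⟨K, hK, -, hKT⟩ := exists_kernel_ballOverlap (E := E) hT
  have : (ballOverlap T : E → ℝ) = fun ω => (𝓕 K ω).re := by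
    ext ω
    simp [hKT]
  rw [this]
  exact Complex.continuous_re.comp (continuous_fourier (memLp_one_iff_integrable.1 hK.1))

theorem aemeasurable_enorm_fourierL2_sq (f : E → ℂ) :
    AEMeasurable (fun ω => ‖fourierL2 f ω‖ₑ ^ 2) volume :=
  (memLp_fourierL2 f).1.enorm.pow_const 2

theorem weightedEnergy_add_weightedEnergy_one_sub {f : E → ℂ} (hf : MemLp f 2 volume) {r : E → ℝ}
    (hr : Measurable r) (h0 : ∀ ω, 0 ≤ r ω) (h1 : ∀ ω, r ω ≤ 1) :
    weightedEnergy r f + weightedEnergy (fun ω => 1 - r ω) f = energy f := by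
  rw [weightedEnergy, weightedEnergy, energy_eq_lintegral_fourierL2 hf, ← lintegral_add_left']
  · refine lintegral_congr fun ω => ?_
    rw [← mul_add, ← ENNReal.ofReal_add (h0 ω) (sub_nonneg.2 (h1 ω))]
    simp
  · exact (aemeasurable_enorm_fourierL2_sq f).mul hr.ennreal_ofReal.aemeasurable

/-- The high-pass weights `1 - ballOverlap (T (j - 1))`, starting with the constant weight `1`. -/
def highPassWeight (T : ℕ → ℝ) : ℕ → E → ℝ
  | 0 => fun _ => 1
  | j + 1 => fun ω => 1 - ballOverlap (T j) ω

theorem highPassWeight_nonneg (T : ℕ → ℝ) (j : ℕ) (ω : E) : 0 ≤ highPassWeight T j ω := by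
  cases j with
  | zero => exact zero_le_one
  | succ j => exact sub_nonneg.2 (ballOverlap_le_one _ _)

theorem highPassWeight_le_one (T : ℕ → ℝ) (j : ℕ) (ω : E) : highPassWeight T j ω ≤ 1 := by
  cases j with
  | zero => exact le_rfl
  | succ j => exact sub_le_self _ (ballOverlap_nonneg _ _)

theorem continuous_highPassWeight {T : ℕ → ℝ} (hT : ∀ j, 0 < T j) (j : ℕ) :
    Continuous (highPassWeight T j : E → ℝ) := by
  cases j with
  | zero => exact continuous_const
  | succ j => exact continuous_const.sub (continuous_ballOverlap (hT j))

/-- For `j = 0` the modulus preserves energy. Otherwise the weight is the complement of an overlap: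
total energies agree and the overlap part can only grow. -/
theorem weightedEnergy_norm_le {T : ℕ → ℝ} (hT : ∀ j, 0 < T j) (j : ℕ) {h : E → ℂ}
    (hh : MemLp h 2 volume) (ν : E) :
    weightedEnergy (highPassWeight T j) (fun x => ((‖h x‖ : ℝ) : ℂ))
      ≤ weightedEnergy (fun ω => highPassWeight T j (ω - ν)) h := by
  have hh' := memLp_norm_ofReal hh
  cases j with
  | zero =>
    simp only [highPassWeight]
    rw [weightedEnergy_one hh, weightedEnergy_one hh', energy_norm_ofReal]
  | succ j =>
    simp only [highPassWeight]
    obtain ⟨K, hK, hK0, hKT⟩ := exists_kernel_ballOverlap (E := E) (hT j)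
    have hle : weightedEnergy (fun ω => ballOverlap (T j) (ω - ν)) h
        ≤ weightedEnergy (ballOverlap (T j)) (fun x => ((‖h x‖ : ℝ) : ℂ)) :=
      lintegral_fourierL2_mul_sub_le hh hK hK0 (ballOverlap_nonneg (T j)) hKT ν
    have hc := continuous_ballOverlap (E := E) (hT j)
    have e1 := weightedEnergy_add_weightedEnergy_one_sub hh' hc.measurable
      (ballOverlap_nonneg (T j)) (ballOverlap_le_one (T j))
    have e2 := weightedEnergy_add_weightedEnergy_one_sub hh
      (r := fun ω => ballOverlap (T j) (ω - ν)) (hc.comp (continuous_sub_right ν)).measurable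
      (fun ω => ballOverlap_nonneg (T j) _) (fun ω => ballOverlap_le_one (T j) _)
    rw [energy_norm_ofReal, ← e2] at e1
    -- Finiteness is what permits cancelling the overlap part in `ℝ≥0∞`.
    have hfin : weightedEnergy (ballOverlap (T j)) (fun x => ((‖h x‖ : ℝ) : ℂ)) ≠ ∞ := by
      refine ne_top_of_le_ne_top (energy_lt_top hh).ne ?_
      rw [← e2, ← e1]
      exact le_self_add
    refine (ENNReal.add_le_add_iff_left hfin).1 ?_
    rw [e1]
    gcongr

namespace ModuleSequence

/-- The filters are high-pass, with a gap of radius `T 0`, and the spectrum of every filter can be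
shifted towards the origin so that frequencies below `T (j + 1)` shrink by a factor of at least
`T j / T (j + 1)`. -/
structure Demodulates (Ω : ModuleSequence.{u} E) (T : ℕ → ℝ) : Prop where
  pos : ∀ j, 0 < T j
  exists_shift : ∀ (n : ℕ) (k : Ω.Λ n), ∃ ν : E, ∀ᵐ ω ∂(volume : Measure E), 𝓕 (Ω.g n k) ω ≠ 0 →
    T 0 ≤ ‖ω‖ ∧ ∀ j, T (j + 1) ≤ ‖ω‖ ∨ ‖ω - ν‖ * T (j + 1) ≤ ‖ω‖ * T j

theorem Demodulates.highPassWeight_sub_le {T : ℕ → ℝ} (hT : ∀ j, 0 < T j) {ω ν : E}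
    (h : T 0 ≤ ‖ω‖ ∧ ∀ j, T (j + 1) ≤ ‖ω‖ ∨ ‖ω - ν‖ * T (j + 1) ≤ ‖ω‖ * T j) (j : ℕ) :
    highPassWeight T j (ω - ν) ≤ highPassWeight T (j + 1) ω := by
  cases j with
  | zero => simp [highPassWeight, ballOverlap_eq_zero h.1]
  | succ j =>
    rcases h.2 j with h | h
    · refine (highPassWeight_le_one _ _ _).trans ?_
      simp [highPassWeight, ballOverlap_eq_zero h]
    · exact sub_le_sub_left (ballOverlap_le_ballOverlap (hT j) (hT (j + 1)) h) 1

variable {Ω : ModuleSequence.{u} E}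

theorem IsParseval.energy_add_tsum_energy (hP : Ω.IsParseval) (n : ℕ) {f : E → ℂ}
    (hf : MemLp f 2 volume) :
    energy (conv f (Ω.χ n)) + ∑' k : Ω.Λ n, energy (conv f (Ω.g n k)) = energy f := by
  have h := (hP n).2.2 f hf
  simp only [ENNReal.ofReal_one, one_mul] at h
  exact le_antisymm h.2 h.1

theorem tsum_weightedEnergy_le {T : ℕ → ℝ} (hF : Ω.FiltersMemL1L2) (hP : Ω.IsParseval)
    (hD : Ω.Demodulates T) (n j : ℕ) {f : E → ℂ} (hf : MemLp f 2 volume) :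
    ∑' k : Ω.Λ n, weightedEnergy (highPassWeight T j)
        (fun x => ((‖conv f (Ω.g n k) x‖ : ℝ) : ℂ))
      ≤ weightedEnergy (highPassWeight T (j + 1)) f := by
  set w : E → ℝ := highPassWeight T (j + 1)
  have hw0 : ∀ ω, 0 ≤ w ω := highPassWeight_nonneg T (j + 1)
  -- The weight is absorbed into an auxiliary signal `f'` with transform `√w f̂`, so that Parseval
  -- for `f'` sums the weighted energies of all filters at once.
  have hu : MemLp (fun ω => ((√(w ω) : ℝ) : ℂ) * fourierL2 f ω) 2 volume := by
    have hb : MemLp (fun ω => ((√(w ω) : ℝ) : ℂ)) ∞ (volume : Measure E) := by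
      refine memLp_top_of_bound (Complex.continuous_ofReal.comp
        (Real.continuous_sqrt.comp (continuous_highPassWeight hD.pos _))).aestronglyMeasurable 1 ?_
      refine Filter.Eventually.of_forall fun ω => ?_
      rw [Complex.norm_real, Real.norm_of_nonneg (Real.sqrt_nonneg _)]
      exact Real.sqrt_le_one.2 (highPassWeight_le_one _ _ _)
    exact (memLp_fourierL2 f).mul (r := 2) hb
  obtain ⟨f', hf', hff'⟩ := exists_fourierL2_eq hu
  have hsq : ∀ᵐ ω ∂(volume : Measure E),
      ‖fourierL2 f' ω‖ₑ ^ 2 = ‖fourierL2 f ω‖ₑ ^ 2 * ENNReal.ofReal (w ω) := by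
    filter_upwards [hff'] with ω hω
    rw [hω, enorm_mul, mul_pow, mul_comm, ← ofReal_norm ((√(w ω) : ℝ) : ℂ), Complex.norm_real,
      Real.norm_of_nonneg (Real.sqrt_nonneg _), ← ENNReal.ofReal_pow (Real.sqrt_nonneg _),
      Real.sq_sqrt (hw0 ω)]
  have hterm : ∀ k : Ω.Λ n, weightedEnergy (highPassWeight T j)
      (fun x => ((‖conv f (Ω.g n k) x‖ : ℝ) : ℂ)) ≤ energy (conv f' (Ω.g n k)) := by
    intro k
    have hg := (hF n).2 k
    obtain ⟨ν, hν⟩ := hD.exists_shift n k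
    refine (weightedEnergy_norm_le hD.pos j (memLp_conv hf hg) ν).trans ?_
    rw [energy_conv hf' hg]
    refine lintegral_mono_ae ?_
    filter_upwards [hν, hsq, fourierL2_conv hf hg] with ω h1 h2 h3
    rw [h2, h3, enorm_mul, mul_pow]
    by_cases h0 : 𝓕 (Ω.g n k) ω = 0
    · simp [h0]
    · rw [mul_right_comm]
      gcongr
      exact Demodulates.highPassWeight_sub_le hD.pos (h1 h0) j
  calc _ ≤ ∑' k : Ω.Λ n, energy (conv f' (Ω.g n k)) := ENNReal.tsum_le_tsum hterm
    _ ≤ energy f' := by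
        rw [← hP.energy_add_tsum_energy n hf']
        exact le_add_self
    _ = _ := by
        rw [energy_eq_lintegral_fourierL2 hf']
        exact lintegral_congr_ae hsq

theorem memLp_U (hF : Ω.FiltersMemL1L2) {f : E → ℂ} (hf : MemLp f 2 volume) :
    ∀ (n : ℕ) (q : Ω.Path n), MemLp (Ω.U n q f) 2 volume
  | 0, _ => hf
  | n + 1, _ => memLp_norm_ofReal (memLp_conv (memLp_U hF hf n _) ((hF n).2 _))

theorem tsum_path_succ (n : ℕ) (f : E → ℂ) (F : (E → ℂ) → ℝ≥0∞) :
    ∑' q : Ω.Path (n + 1), F (Ω.U (n + 1) q f)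
      = ∑' (q : Ω.Path n) (k : Ω.Λ n),
          F (fun x => ((‖conv (Ω.U n q f) (Ω.g n k) x‖ : ℝ) : ℂ)) := by
  let e : Ω.Λ n × Ω.Path n ≃ Ω.Path (n + 1) := Fin.snocEquiv fun i : Fin (n + 1) => Ω.Λ i
  rw [← e.tsum_eq, ENNReal.tsum_prod', ENNReal.tsum_comm]
  refine tsum_congr fun q => tsum_congr fun k => ?_
  have h1 : e (k, q) (Fin.last n) = k := Fin.snoc_last (α := fun i : Fin (n + 1) => Ω.Λ i) k q
  have h2 : (fun i : Fin n => e (k, q) i.castSucc) = q :=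
    funext fun i => Fin.snoc_castSucc (α := fun i : Fin (n + 1) => Ω.Λ i) k q i
  simp only [U]
  rw [h1, h2]

theorem tsum_path_zero (f : E → ℂ) (F : (E → ℂ) → ℝ≥0∞) :
    ∑' q : Ω.Path 0, F (Ω.U 0 q f) = F f := by
  have : Unique (Ω.Path 0) := Pi.uniqueOfIsEmpty _
  rw [tsum_eq_single default (fun q hq => absurd (Unique.eq_default q) hq)]
  rfl

/-- The last layer is peeled off, which raises the weight index by one; hence the induction needs
all `j`. -/
theorem tsum_path_weightedEnergy_le {T : ℕ → ℝ} (hF : Ω.FiltersMemL1L2) (hP : Ω.IsParseval)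
    (hD : Ω.Demodulates T) {f : E → ℂ} (hf : MemLp f 2 volume) (n j : ℕ) :
    ∑' q : Ω.Path n, weightedEnergy (highPassWeight T j) (Ω.U n q f)
      ≤ weightedEnergy (highPassWeight T (j + n)) f := by
  induction n generalizing j with
  | zero => rw [tsum_path_zero, add_zero]
  | succ n ih =>
    rw [tsum_path_succ]
    refine (ENNReal.tsum_le_tsum fun q =>
      tsum_weightedEnergy_le hF hP hD n j (memLp_U hF hf n q)).trans ?_
    have := ih (j + 1)
    rwa [add_assoc, add_comm 1 n] at this

theorem sum_featureEnergy_add_tsum_energy (hF : Ω.FiltersMemL1L2) (hP : Ω.IsParseval)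
    {f : E → ℂ} (hf : MemLp f 2 volume) (M : ℕ) :
    ∑ n ∈ Finset.range M, Ω.featureEnergy n f + ∑' q : Ω.Path M, energy (Ω.U M q f)
      = energy f := by
  induction M with
  | zero => rw [tsum_path_zero, Finset.range_zero, Finset.sum_empty, zero_add]
  | succ M ih =>
    rw [Finset.sum_range_succ, add_assoc, tsum_path_succ, featureEnergy, ← ENNReal.tsum_add, ← ih]
    congr 1
    refine tsum_congr fun q => ?_
    simp_rw [energy_norm_ofReal]
    exact hP.energy_add_tsum_energy M (memLp_U hF hf M q)

theorem capturesEnergy_of_weightedEnergy_le {T : ℕ → ℝ} (hF : Ω.FiltersMemL1L2)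
    (hP : Ω.IsParseval) (hD : Ω.Demodulates T) {f : E → ℂ} (hf : MemLp f 2 volume)
    (hf0 : energy f ≠ 0) {ε : ℝ} (hε : 0 ≤ ε) {N : ℕ}
    (h : weightedEnergy (fun ω => 1 - ballOverlap (T N) ω) f ≤ ENNReal.ofReal ε * energy f) :
    Ω.CapturesEnergy ε N f := by
  have hsum := sum_featureEnergy_add_tsum_energy hF hP hf (N + 1)
  have hres : ∑' q : Ω.Path (N + 1), energy (Ω.U (N + 1) q f) ≤ ENNReal.ofReal ε * energy f := by
    refine le_trans ?_ h
    -- Starting from the constant weight `0`, `N + 1` layers end at weight `N + 1`, whose radius is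
    -- `T N`.
    have := tsum_path_weightedEnergy_le hF hP hD hf (N + 1) 0
    rw [zero_add] at this
    refine le_of_eq_of_le (tsum_congr fun q => ?_) this
    exact (weightedEnergy_one (memLp_U hF hf _ q)).symm
  have hfin := (energy_lt_top hf).ne
  constructor
  · rw [ENNReal.le_div_iff_mul_le (Or.inl hf0) (Or.inl hfin), ENNReal.ofReal_sub _ hε,
      ENNReal.ofReal_one, ENNReal.sub_mul (fun _ _ => hfin), one_mul]
    refine tsub_le_iff_right.2 ?_
    nth_rewrite 1 [← hsum]
    gcongr
  · refine ENNReal.div_le_of_le_mul ?_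
    rw [one_mul, ← hsum]
    exact le_self_add

end ModuleSequence

theorem energy_coe (f : Lp (α := E) ℂ 2 volume) : energy f = ENNReal.ofReal (‖f‖ ^ 2) := by
  rw [energy, ← Lp.enorm_def, ENNReal.ofReal_pow (norm_nonneg f), ofReal_norm]

/-- The left side lies in `[0, 1]`, so raising it to the power `γ ≤ 1` does not decrease it; `γ ≤
2s` then lets `‖ω‖ ^ γ` be absorbed by the Sobolev weight. -/
theorem one_sub_ballOverlap_le {T C s : ℝ} (hT : 0 < T) (hs : 0 < s)
    (hC : (Module.finrank ℝ E : ℝ) ≤ C) (ω : E) :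
    1 - ballOverlap T ω ≤ (C / T) ^ (min 1 (2 * s)) * (1 + ‖ω‖ ^ 2) ^ s := by
  set γ := min 1 (2 * s)
  have hγ0 : 0 < γ := lt_min one_pos (by positivity)
  have hγ1 : γ ≤ 1 := min_le_left _ _
  have hγs : γ / 2 ≤ s := by
    have : γ ≤ 2 * s := min_le_right _ _
    linarith
  have hC0 : 0 ≤ C := (Nat.cast_nonneg _).trans hC
  have h1 : 1 - ballOverlap T ω ≤ C / T * ‖ω‖ := by
    have := one_sub_mul_le_ballOverlap hT ω
    have h2 : Module.finrank ℝ E * (‖ω‖ / T) ≤ C * (‖ω‖ / T) := by gcongr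
    calc 1 - ballOverlap T ω ≤ C * (‖ω‖ / T) := by linarith
      _ = _ := by ring
  have hx0 : 0 ≤ 1 - ballOverlap T ω := sub_nonneg.2 (ballOverlap_le_one _ _)
  have hx1 : 1 - ballOverlap T ω ≤ 1 := sub_le_self _ (ballOverlap_nonneg _ _)
  calc 1 - ballOverlap T ω ≤ (1 - ballOverlap T ω) ^ γ :=
        Real.self_le_rpow_of_le_one hx0 hx1 hγ1
    _ ≤ (C / T * ‖ω‖) ^ γ := Real.rpow_le_rpow hx0 h1 hγ0.le
    _ = (C / T) ^ γ * ‖ω‖ ^ γ := Real.mul_rpow (by positivity) (norm_nonneg _)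
    _ ≤ (C / T) ^ γ * (1 + ‖ω‖ ^ 2) ^ s := by
        gcongr
        calc ‖ω‖ ^ γ = (‖ω‖ ^ 2) ^ (γ / 2) := by
              rw [← Real.rpow_natCast, ← Real.rpow_mul (norm_nonneg _)]
              congr 1
              push_cast
              ring
          _ ≤ (1 + ‖ω‖ ^ 2) ^ (γ / 2) := by gcongr; linarith
          _ ≤ (1 + ‖ω‖ ^ 2) ^ s :=
              Real.rpow_le_rpow_of_exponent_le (by linarith [sq_nonneg ‖ω‖]) hγs

theorem weightedEnergy_one_sub_ballOverlap_le {T C s : ℝ} (hT : 0 < T) (hs : 0 < s)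
    (hC : (Module.finrank ℝ E : ℝ) ≤ C) {f : Lp (α := E) ℂ 2 volume} (hf : MemHs s f) :
    weightedEnergy (fun ω => 1 - ballOverlap T ω) f
      ≤ ENNReal.ofReal ((C / T) ^ (min 1 (2 * s)) * sobolevNorm s f ^ 2) := by
  have hC0 : 0 ≤ C := (Nat.cast_nonneg _).trans hC
  have hc : (0 : ℝ) ≤ (C / T) ^ (min 1 (2 * s)) := by positivity
  rw [sobolevNorm, Real.sq_sqrt ENNReal.toReal_nonneg, ENNReal.ofReal_mul hc,
    ENNReal.ofReal_toReal hf.ne, sobolevEnergy, ← lintegral_const_mul' _ _ ENNReal.ofReal_ne_top,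
    weightedEnergy, fourierL2_coe]
  refine lintegral_mono fun ω => ?_
  rw [mul_left_comm, ← ENNReal.ofReal_mul hc]
  gcongr
  exact one_sub_ballOverlap_le hT hs hC ω

theorem ModuleSequence.capturesEnergy_of_layerRatio_le {Ω : ModuleSequence.{u} E} {T : ℕ → ℝ}
    (hF : Ω.FiltersMemL1L2) (hP : Ω.IsParseval) (hD : Ω.Demodulates T) {l ε s δ : ℝ}
    (hl : (Module.finrank ℝ E : ℝ) ≤ 2 * l) (hε : 0 < ε) (hs : 0 < s) (hδ : 0 < δ)
    {f : Lp (α := E) ℂ 2 volume} (hf : MemHs s f) (hf0 : f ≠ 0) {N : ℕ}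
    (hN : layerRatio l s ε δ f * δ ≤ T N) : Ω.CapturesEnergy ε N f := by
  have hn : 0 < ‖f‖ := norm_pos_iff.2 hf0
  have hT := hD.pos N
  refine capturesEnergy_of_weightedEnergy_le hF hP hD (Lp.memLp f) ?_ hε.le ?_
  · rw [energy_coe]
    exact (ENNReal.ofReal_pos.2 (by positivity)).ne'
  · refine (weightedEnergy_one_sub_ballOverlap_le hT hs hl hf).trans ?_
    rw [energy_coe, ← ENNReal.ofReal_mul hε.le]
    refine ENNReal.ofReal_le_ofReal ?_
    rw [layerRatio] at hN
    set γ := min 1 (2 * s)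
    have hγ0 : 0 < γ := lt_min one_pos (by positivity)
    have hl0 : 0 ≤ 2 * l := (Nat.cast_nonneg _).trans hl
    set X := sobolevNorm s f
    have hX : 0 ≤ X := Real.sqrt_nonneg _
    have hpow : ∀ x : ℝ, 0 ≤ x → (x ^ (2 / γ)) ^ γ = x ^ 2 := fun x hx => by
      rw [← Real.rpow_mul hx, div_mul_cancel₀ _ hγ0.ne', Real.rpow_two]
    have hεp : (ε ^ (1 / γ)) ^ γ = ε := by
      rw [← Real.rpow_mul hε.le, one_div_mul_cancel hγ0.ne', Real.rpow_one]
    -- This is the `γ`-th root of the desired inequality, and `hN` with denominators cleared.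
    have hbase : 2 * l / T N * X ^ (2 / γ) ≤ ε ^ (1 / γ) * ‖f‖ ^ (2 / γ) := by
      have hq : 0 < ε ^ (1 / γ) * ‖f‖ ^ (2 / γ) := by positivity
      have e : 2 * l * X ^ (2 / γ) / (ε ^ (1 / γ) * δ * ‖f‖ ^ (2 / γ)) * δ
          = 2 * l * X ^ (2 / γ) / (ε ^ (1 / γ) * ‖f‖ ^ (2 / γ)) := by
        field_simp
      rw [e, div_le_iff₀ hq] at hN
      rw [div_mul_eq_mul_div, div_le_iff₀ hT, mul_comm _ (T N)]
      exact hN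
    have := Real.rpow_le_rpow (by positivity) hbase hγ0.le
    rwa [Real.mul_rpow (by positivity) (by positivity), Real.mul_rpow (by positivity)
      (by positivity), hpow X hX, hpow _ hn.le, hεp] at this

theorem layerRatio_nonneg {l s ε δ : ℝ} (hl : 0 ≤ l) (hε : 0 ≤ ε) (hδ : 0 ≤ δ)
    (f : Lp (α := E) ℂ 2 volume) : 0 ≤ layerRatio l s ε δ f := by
  have : 0 ≤ sobolevNorm s f := Real.sqrt_nonneg _
  unfold layerRatio
  positivity

end Network

/-! ### Analytic filters: polynomially growing radii. -/

section RotatedOrthants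

theorem norm_toEuclideanLin_orthogonal {d : ℕ} (A : Matrix.orthogonalGroup (Fin d) ℝ)
    (x : EuclideanSpace ℝ (Fin d)) :
    ‖Matrix.toEuclideanLin (A : Matrix (Fin d) (Fin d) ℝ) x‖ = ‖x‖ := by
  have hA : (A : Matrix (Fin d) (Fin d) ℝ).transpose * (A : Matrix (Fin d) (Fin d) ℝ) = 1 :=
    (Matrix.mem_orthogonalGroup_iff' _ _).1 A.2
  have hdot : ∀ y : EuclideanSpace ℝ (Fin d), ‖y‖ ^ 2 = y.ofLp ⬝ᵥ y.ofLp := fun y => by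
    rw [EuclideanSpace.real_norm_sq_eq]
    simp [dotProduct, sq]
  rw [← sq_eq_sq₀ (norm_nonneg _) (norm_nonneg _), hdot, hdot, Matrix.ofLp_toLpLin, Matrix.toLin'_apply,
    Matrix.dotProduct_mulVec, ← Matrix.mulVec_transpose, Matrix.mulVec_mulVec, hA,
    Matrix.one_mulVec]

/-- Moving from a point of a rotated orthant towards the origin, along the axis of the orthant. -/
theorem exists_norm_sub_sq_le_of_mem_rotatedOrthant {d : ℕ} (hd : 1 ≤ d)
    (A : Matrix.orthogonalGroup (Fin d) ℝ) {δ : ℝ} (hδ : 0 ≤ δ) :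
    ∃ ν : EuclideanSpace ℝ (Fin d), ∀ ω ∈ rotatedOrthant A,
      ‖ω - ν‖ ^ 2 ≤ ‖ω‖ ^ 2 - (2 * δ * ‖ω‖ - δ ^ 2) / d := by
  -- The shift has length `δ / √d` along the diagonal of the orthant; its inner product with `x` is
  -- `δ / d` times the coordinate sum, which is at least `‖x‖` on the orthant.
  set c : EuclideanSpace ℝ (Fin d) := WithLp.toLp 2 fun _ => δ / d with hc
  refine ⟨Matrix.toEuclideanLin (A : Matrix (Fin d) (Fin d) ℝ) c, ?_⟩
  rintro ω ⟨x, hx, rfl⟩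
  have hd0 : (0 : ℝ) < d := by exact_mod_cast hd
  rw [← map_sub, norm_toEuclideanLin_orthogonal, norm_toEuclideanLin_orthogonal]
  have hsum : ‖x‖ ≤ ∑ k, x k := by
    refine le_of_sq_le_sq ?_ (Finset.sum_nonneg fun k _ => hx k)
    rw [EuclideanSpace.real_norm_sq_eq]
    exact Finset.sum_sq_le_sq_sum_of_nonneg fun k _ => hx k
  have e : ‖x - c‖ ^ 2 = ‖x‖ ^ 2 - (2 * δ * ∑ k, x k - δ ^ 2) / d := by
    rw [EuclideanSpace.real_norm_sq_eq, EuclideanSpace.real_norm_sq_eq]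
    have : ∀ k, ((x - c) k) ^ 2 = x k ^ 2 - 2 * (δ / d) * x k + (δ / d) ^ 2 := fun k => by
      simp only [hc, PiLp.sub_apply]
      ring
    simp_rw [this]
    rw [Finset.sum_add_distrib, Finset.sum_sub_distrib, ← Finset.mul_sum, Finset.sum_const,
      Finset.card_univ, Fintype.card_fin, nsmul_eq_mul]
    field_simp
    ring
  rw [e]
  gcongr

theorem decayExponent_of_two_le {d : ℕ} (hd : 2 ≤ d) :
    0 < decayExponent d ∧ 2 * decayExponent d ≤ 1 ∧
      (1 / 2 : ℝ) ^ (2 * decayExponent d) = 1 - 1 / (2 * d) := by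
  have hd2 : (2 : ℝ) ≤ d := by exact_mod_cast hd
  have h1 : 1 < (d : ℝ) / (d - 1 / 2) := by rw [one_lt_div (by linarith)]; linarith
  have h2 : (d : ℝ) / (d - 1 / 2) ≤ 2 := by rw [div_le_iff₀ (by linarith)]; linarith
  have e : 2 * decayExponent d = Real.logb 2 ((d : ℝ) / (d - 1 / 2)) := by
    rw [decayExponent, if_neg (by omega), Real.logb, Real.logb, Real.log_sqrt (by linarith)]
    ring
  refine ⟨?_, ?_, ?_⟩
  · have := Real.logb_pos (b := 2) (by norm_num) h1
    linarith
  · rw [e, Real.logb_le_iff_le_rpow (by norm_num) (by linarith)]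
    simpa using h2
  · rw [e, one_div, Real.inv_rpow (by norm_num), Real.rpow_logb (by norm_num) (by norm_num)
      (by linarith)]
    field_simp

theorem decayExponent_pos {d : ℕ} (hd : 1 ≤ d) : 0 < decayExponent d := by
  rcases hd.eq_or_lt with rfl | hd
  · simp [decayExponent]
  · exact (decayExponent_of_two_le hd).1

/-- The concave function `y ↦ y ^ (2α)` lies above its chord over `[1/2, 1]`. The exponent `α` is
chosen so that this chord is exactly `1 - x / d`. -/
theorem one_sub_div_le_rpow {d : ℕ} (hd : 2 ≤ d) {x : ℝ} (h0 : 0 ≤ x) (h1 : x ≤ 1 / 2) :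
    1 - x / d ≤ (1 - x) ^ (2 * decayExponent d) := by
  obtain ⟨hp, hle, hhalf⟩ := decayExponent_of_two_le hd
  have hc := (Real.concaveOn_rpow (by positivity) hle).2 (Set.mem_Ici.2 zero_le_one)
    (Set.mem_Ici.2 one_half_pos.le) (by linarith : 0 ≤ 1 - 2 * x) (by linarith : 0 ≤ 2 * x)
    (by ring)
  simp only [smul_eq_mul, hhalf, Real.one_rpow] at hc
  have hd0 : (0 : ℝ) < d := by positivity
  calc 1 - x / d = (1 - 2 * x) * 1 + 2 * x * (1 - 1 / (2 * d)) := by field_simp; ring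
    _ ≤ _ := hc
    _ = _ := by congr 1; ring

/-- The contraction achieved by a shift of size `δ` along the axis of an orthant. -/
theorem mul_rpow_le_mul_rpow {d : ℕ} (hd : 1 ≤ d) {δ t y : ℝ} (hδ : 0 < δ) (ht : δ ≤ t)
    (hy : 0 ≤ y) (hyt : y ^ 2 ≤ t ^ 2 - (2 * δ * t - δ ^ 2) / d) {n : ℝ} (hn : 1 ≤ n)
    (htn : t ≤ (n + 1) ^ decayExponent d * δ) :
    y * (n + 1) ^ decayExponent d ≤ t * n ^ decayExponent d := by
  have ht0 : 0 < t := hδ.trans_le ht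
  rcases hd.eq_or_lt with rfl | hd
  · simp only [decayExponent, if_true, Real.rpow_one, Nat.cast_one, div_one] at *
    have : y ≤ t - δ := le_of_sq_le_sq (by nlinarith) (by linarith)
    nlinarith
  · have hd2 : 2 ≤ d := hd
    obtain ⟨hp, hle, -⟩ := decayExponent_of_two_le hd2
    set α := decayExponent d
    have hd0 : (0 : ℝ) < d := by positivity
    have hn0 : 0 < n + 1 := by linarith
    -- Since `α ≤ 1`, the range of `t` gives `t ≤ (n + 1) δ`, so the shift `δ` is at least the
    -- fraction `1 / (n + 1)` of `t`.
    have hα : (n + 1) ^ α ≤ n + 1 := by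
      simpa using Real.rpow_le_rpow_of_exponent_le (by linarith : 1 ≤ n + 1) (by linarith : α ≤ 1)
    have ht' : t / (n + 1) ≤ δ := by
      rw [div_le_iff₀ hn0, mul_comm]
      exact htn.trans (by gcongr)
    -- Here `n ≥ 1` is what places `1 / (n + 1)` in `[0, 1/2]`.
    have key := one_sub_div_le_rpow hd2 (x := 1 / (n + 1)) (by positivity)
      (by rw [div_le_div_iff₀ hn0 two_pos]; linarith)
    have e : 1 - 1 / (n + 1) = n / (n + 1) := by field_simp; ring
    rw [e] at key
    have h1 : y ^ 2 ≤ t ^ 2 * (1 - 1 / (n + 1) / d) := by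
      have h2 : t ^ 2 * (1 / (n + 1) / d) ≤ (2 * δ * t - δ ^ 2) / d := by
        rw [← mul_div_assoc]
        gcongr
        have : t ^ 2 * (1 / (n + 1)) = t / (n + 1) * t := by field_simp
        nlinarith
      rw [mul_sub]
      linarith
    have h3 : y ^ 2 ≤ (t * (n / (n + 1)) ^ α) ^ 2 := by
      rw [mul_pow, ← Real.rpow_natCast (_ ^ α), ← Real.rpow_mul (by positivity), mul_comm α]
      refine h1.trans ?_
      gcongr
      exact_mod_cast key
    have h4 : y ≤ t * (n / (n + 1)) ^ α := le_of_sq_le_sq h3 (by positivity)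
    rw [Real.div_rpow (by linarith) hn0.le, ← mul_div_assoc, le_div_iff₀ (by positivity)] at h4
    exact h4

theorem ModuleSequence.AnalyticHighPass.demodulates {d : ℕ} (hd : 1 ≤ d)
    {Ω : ModuleSequence.{u} (EuclideanSpace ℝ (Fin d))} {δ : ℝ} (hδ : 0 < δ)
    (h : Ω.AnalyticHighPass δ) :
    Ω.Demodulates fun j => ((j : ℝ) + 1) ^ decayExponent d * δ where
  pos j := by positivity
  exists_shift n k := by
    obtain ⟨A, hA⟩ := h.analytic n k
    obtain ⟨ν, hν⟩ := exists_norm_sub_sq_le_of_mem_rotatedOrthant hd A hδ.le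
    refine ⟨ν, ?_⟩
    filter_upwards [h.gap n] with ω hω h0
    have hδω : δ ≤ ‖ω‖ := by
      by_contra! hlt
      have := ENNReal.tsum_eq_zero.1 (hω (mem_ball_zero_iff.2 hlt)) k
      exact h0 (by simpa using this)
    refine ⟨by simpa using hδω, fun j => or_iff_not_imp_left.2 fun hlt => ?_⟩
    have := mul_rpow_le_mul_rpow hd hδ hδω (norm_nonneg _)
      (hν ω (hA (subset_tsupport _ h0))) (n := (j : ℝ) + 1) (by simp)
      (by push_cast at hlt; exact (not_le.1 hlt).le)
    push_cast
    rw [← mul_assoc, ← mul_assoc]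
    exact mul_le_mul_of_nonneg_right this hδ.le

end RotatedOrthants

/-! ### Wavelets: radii growing like `(5/3)^j`. -/

section Wavelets

theorem memLp_mul_comp_mul_left {p : ℝ≥0∞} {ψ : ℝ → ℂ} (h : MemLp ψ p volume) (b : ℂ) {a : ℝ}
    (ha : a ≠ 0) : MemLp (fun x => b * ψ (a * x)) p volume := by
  refine MemLp.const_mul ?_ b
  have hm : MemLp ψ p (Measure.map (fun x => a * x) volume) := by
    rw [Real.map_volume_mul_left ha]
    exact h.smul_measure ENNReal.ofReal_ne_top
  exact (memLp_map_measure_iff hm.1 (by fun_prop)).1 hm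

theorem fourier_abs_mul_comp_mul_left (ψ : ℝ → ℂ) {a : ℝ} (ha : a ≠ 0) (ω : ℝ) :
    𝓕 (fun x => ((|a| : ℝ) : ℂ) * ψ (a * x)) ω = 𝓕 ψ (a⁻¹ * ω) := by
  rw [Real.fourier_eq, Real.fourier_eq]
  have h := Measure.integral_comp_mul_left
    (fun y => Real.fourierChar (-inner ℝ y (a⁻¹ * ω)) • ψ y) a
  have hc : ((|a| : ℝ) : ℂ) * ((|a⁻¹| : ℝ) : ℂ) = 1 := by
    rw [← Complex.ofReal_mul, ← abs_mul, mul_inv_cancel₀ ha]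
    simp
  calc ∫ x, Real.fourierChar (-inner ℝ x ω) • (((|a| : ℝ) : ℂ) * ψ (a * x))
      = ((|a| : ℝ) : ℂ) * ∫ x, Real.fourierChar (-inner ℝ (a * x) (a⁻¹ * ω)) • ψ (a * x) := by
        rw [← integral_const_mul]
        refine integral_congr_ae (Filter.Eventually.of_forall fun x => ?_)
        have e : inner ℝ (a * x) (a⁻¹ * ω) = inner ℝ x ω := by
          simp only [RCLike.inner_apply, conj_trivial]
          field_simp
        simp only [e, Circle.smul_def, smul_eq_mul]
        ring
    _ = _ := by
        rw [h, Complex.real_smul, ← mul_assoc, hc, one_mul]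

variable {ψ φ : ℝ → ℂ}

theorem waveletModule_g_eq (j : {j : ℤ // j ≠ 0}) : ∃ m : ℕ, 1 ≤ m ∧ ∃ a : ℝ,
    (a = 2 ^ m ∨ a = -2 ^ m) ∧
      ∀ n, (waveletModule ψ φ).g n j = fun x => ((|a| : ℝ) : ℂ) * ψ (a * x) := by
  have hpos : (0 : ℝ) < 2 ^ j.1.natAbs := by positivity
  refine ⟨j.1.natAbs, Int.natAbs_pos.2 j.2, ?_⟩
  by_cases h : 0 < j.1
  · refine ⟨2 ^ j.1.natAbs, Or.inl rfl, fun n => ?_⟩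
    ext x
    simp [waveletModule, h]
  · refine ⟨-2 ^ j.1.natAbs, Or.inr rfl, fun n => ?_⟩
    ext x
    simp [waveletModule, h]

theorem IsWaveletPair.filtersMemL1L2 (h : IsWaveletPair ψ φ) :
    (waveletModule ψ φ).FiltersMemL1L2 := by
  refine fun n => ⟨h.memφ, fun j => ?_⟩
  obtain ⟨m, -, a, ha, hg⟩ := waveletModule_g_eq (ψ := ψ) (φ := φ) j
  have ha0 : a ≠ 0 := by rcases ha with rfl | rfl <;> simp
  rw [hg]
  exact ⟨memLp_mul_comp_mul_left h.memψ.1 _ ha0, memLp_mul_comp_mul_left h.memψ.2 _ ha0⟩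

theorem IsWaveletPair.demodulates (h : IsWaveletPair ψ φ) :
    (waveletModule ψ φ).Demodulates fun j => (5 / 3 : ℝ) ^ j * 1 where
  pos j := by positivity
  exists_shift n k := by
    obtain ⟨m, hm, a, ha, hg⟩ := waveletModule_g_eq (ψ := ψ) (φ := φ) k
    have ha0 : a ≠ 0 := by rcases ha with rfl | rfl <;> simp
    -- The harmonic mean `4/5` of `1/2` and `2` balances the relative distance on `[1/2, 2]`: `|x -
    -- 4/5| / x` equals `3/5` at both endpoints.
    refine ⟨4 / 5 * a, Filter.Eventually.of_forall fun ω hω => ?_⟩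
    rw [hg, fourier_abs_mul_comp_mul_left ψ ha0] at hω
    obtain ⟨h1, h2⟩ := h.supp (subset_tsupport _ hω)
    set x := a⁻¹ * ω
    have hx : ω = a * x := (mul_inv_cancel_left₀ ha0 ω).symm
    have ha2 : 2 ≤ |a| := by
      have : (2 : ℝ) ≤ 2 ^ m := le_self_pow₀ (by norm_num) (by omega)
      rcases ha with rfl | rfl
      · rwa [abs_of_nonneg (by positivity)]
      · rwa [abs_neg, abs_of_nonneg (by positivity)]
    have hω' : ‖ω‖ = |a| * x := by
      rw [hx, norm_mul, Real.norm_eq_abs, Real.norm_of_nonneg (by linarith)]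
    refine ⟨by rw [hω']; norm_num; nlinarith, fun j => Or.inr ?_⟩
    have hs : ‖ω - 4 / 5 * a‖ = |a| * |x - 4 / 5| := by
      rw [hx, ← abs_mul, Real.norm_eq_abs]
      congr 1
      ring
    have hd : |x - 4 / 5| ≤ 3 / 5 * x := abs_le.2 ⟨by linarith, by linarith⟩
    rw [hs, hω']
    calc |a| * |x - 4 / 5| * ((5 / 3) ^ (j + 1) * 1)
        ≤ |a| * (3 / 5 * x) * ((5 / 3) ^ (j + 1) * 1) := by gcongr
      _ = _ := by rw [pow_succ]; ring

end Wavelets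

/-! ### Weyl–Heisenberg filters: radii growing like `(3/2)^j`. -/

section WeylHeisenberg

variable {R : ℝ} {g φ : ℝ → ℂ}

theorem weylHeisenbergModule_g_eq (k : {k : ℤ // k ≠ 0}) : ∃ m : ℝ, 1 ≤ m ∧ ∃ c : ℝ,
    (c = (m + 1) * R ∨ c = -((m + 1) * R)) ∧
      ∀ n, (weylHeisenbergModule R g φ).g n k = modulate c g := by
  refine ⟨k.1.natAbs, by exact_mod_cast Int.natAbs_pos.2 k.2, ?_⟩
  by_cases h : 0 < k.1
  · refine ⟨(k.1.natAbs + 1) * R, Or.inl rfl, fun n => ?_⟩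
    ext x
    simp only [weylHeisenbergModule, h, if_true, modulate, Real.fourierChar_apply,
      RCLike.inner_apply, conj_trivial]
    congr 2
    push_cast
    ring
  · refine ⟨-((k.1.natAbs + 1) * R), Or.inr rfl, fun n => ?_⟩
    ext x
    simp only [weylHeisenbergModule, h, if_false, modulate, Real.fourierChar_apply,
      RCLike.inner_apply, conj_trivial]
    congr 2
    push_cast
    ring

theorem IsWeylHeisenbergPair.filtersMemL1L2 (h : IsWeylHeisenbergPair R g φ) :
    (weylHeisenbergModule R g φ).FiltersMemL1L2 := by
  refine fun n => ⟨h.memφ, fun k => ?_⟩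
  obtain ⟨m, -, c, -, hg⟩ := weylHeisenbergModule_g_eq (R := R) (g := g) (φ := φ) k
  rw [hg]
  exact memL1L2_modulate h.memg c

theorem IsWeylHeisenbergPair.demodulates (hR : 0 < R) (h : IsWeylHeisenbergPair R g φ) :
    (weylHeisenbergModule R g φ).Demodulates fun j => (3 / 2 : ℝ) ^ j * R where
  pos j := by positivity
  exists_shift n k := by
    obtain ⟨m, hm, c, hc, hg⟩ := weylHeisenbergModule_g_eq (R := R) (g := g) (φ := φ) k
    have hmR : R ≤ m * R := le_mul_of_one_le_left hR.le hm
    have key : ∃ ν : ℝ, ∀ ω : ℝ, |ω - c| ≤ R → R ≤ |ω| ∧ |ω - ν| ≤ 2 / 3 * |ω| := by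
      rcases hc with rfl | rfl
      -- The band is `[m R, (m + 2) R]`. The ratio `2/3` requires `ω / 3 ≤ ν ≤ 5 ω / 3`; this `ν` is
      -- the least one allowed by the far end, and `m ≥ 1` covers the near end.
      · refine ⟨(m + 2) * R / 3, fun ω hω => ?_⟩
        obtain ⟨h1, h2⟩ := abs_le.1 hω
        rw [abs_of_nonneg (by linarith : 0 ≤ ω)]
        exact ⟨by linarith, abs_le.2 ⟨by linarith, by linarith⟩⟩
      · refine ⟨-((m + 2) * R / 3), fun ω hω => ?_⟩
        obtain ⟨h1, h2⟩ := abs_le.1 hω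
        rw [abs_of_nonpos (by linarith : ω ≤ 0)]
        exact ⟨by linarith, abs_le.2 ⟨by linarith, by linarith⟩⟩
    obtain ⟨ν, hν⟩ := key
    refine ⟨ν, Filter.Eventually.of_forall fun ω hω => ?_⟩
    rw [hg, fourier_modulate] at hω
    obtain ⟨h1, h2⟩ := hν ω (abs_le.2 (h.supp (subset_tsupport _ hω)))
    refine ⟨by simpa using h1, fun j => Or.inr ?_⟩
    rw [Real.norm_eq_abs, Real.norm_eq_abs]
    calc |ω - ν| * ((3 / 2) ^ (j + 1) * R) ≤ 2 / 3 * |ω| * ((3 / 2) ^ (j + 1) * R) := by gcongr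
      _ = _ := by rw [pow_succ]; ring

end WeylHeisenberg

/-! ### From the radii to the number of layers. -/

theorem le_pow_of_ceil_logb_le {a x : ℝ} (ha : 1 < a) (hx : 0 ≤ x) {N : ℕ}
    (h : ⌈Real.logb a x⌉ ≤ (N : ℤ)) : x ≤ a ^ N := by
  rcases hx.eq_or_lt with rfl | hx
  · positivity
  · have : Real.logb a x ≤ N := by exact_mod_cast Int.ceil_le.1 h
    rw [Real.logb_le_iff_le_rpow ha hx, Real.rpow_natCast] at this
    exact this

end

theorem corollary2 :
    -- (i) general analytic high-pass filters
    (∀ (d : ℕ), 1 ≤ d →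
      ∀ (Ω : ModuleSequence.{u} (EuclideanSpace ℝ (Fin d))) (δ : ℝ), 0 < δ →
        Ω.FiltersMemL1L2 → Ω.IsParseval → Ω.AnalyticHighPass δ →
        ∀ (l ε s : ℝ), ((d / 2 : ℕ) : ℝ) + 1 < l → 0 < ε → ε < 1 → 0 < s →
        ∀ f : Lp (α := EuclideanSpace ℝ (Fin d)) ℂ 2 volume, MemHs s f → f ≠ 0 →
        ∀ N : ℕ, ⌈layerRatio l s ε δ f ^ (1 / decayExponent d) - 1⌉ ≤ (N : ℤ) →
          Ω.CapturesEnergy ε N f) ∧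
    -- (ii) wavelets, with `a = 5/3` and `δ = 1`
    (∀ (ψ φ : ℝ → ℂ), IsWaveletPair ψ φ → (waveletModule ψ φ).IsParseval →
        ∀ (l ε s : ℝ), 1 < l → 0 < ε → ε < 1 → 0 < s →
        ∀ f : Lp (α := ℝ) ℂ 2 volume, MemHs s f → f ≠ 0 →
        ∀ N : ℕ, ⌈Real.logb (5 / 3) (layerRatio l s ε 1 f)⌉ ≤ (N : ℤ) →
          (waveletModule ψ φ).CapturesEnergy ε N f) ∧
    -- (ii) Weyl-Heisenberg filters, with `a = 3/2` and `δ = R`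
    (∀ (R : ℝ), 0 < R →
      ∀ (g φ : ℝ → ℂ), IsWeylHeisenbergPair R g φ → (weylHeisenbergModule R g φ).IsParseval →
        ∀ (l ε s : ℝ), 1 < l → 0 < ε → ε < 1 → 0 < s →
        ∀ f : Lp (α := ℝ) ℂ 2 volume, MemHs s f → f ≠ 0 →
        ∀ N : ℕ, ⌈Real.logb (3 / 2) (layerRatio l s ε R f)⌉ ≤ (N : ℤ) →
          (weylHeisenbergModule R g φ).CapturesEnergy ε N f) := by
  refine ⟨?_, ?_, ?_⟩
  · intro d hd Ω δ hδ hF hP hA l ε s hl hε _ hs f hf hf0 N hN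
    -- The factor `2 l` only has to dominate the constant `d` of the overlap estimate.
    have hl0 : (d : ℝ) ≤ 2 * l := by
      have : d ≤ 2 * (d / 2 + 1) := by omega
      have : (d : ℝ) ≤ 2 * (((d / 2 : ℕ) : ℝ) + 1) := by exact_mod_cast this
      linarith
    have hr : 0 ≤ layerRatio l s ε δ f :=
      layerRatio_nonneg (by linarith [Nat.cast_nonneg (α := ℝ) d]) hε.le hδ.le f
    refine ModuleSequence.capturesEnergy_of_layerRatio_le hF hP (hA.demodulates hd hδ)
      (by simpa using hl0) hε hs hδ hf hf0 ?_
    have hα := decayExponent_pos hd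
    have h1 : layerRatio l s ε δ f ^ (1 / decayExponent d) ≤ (N : ℝ) + 1 := by
      have : layerRatio l s ε δ f ^ (1 / decayExponent d) - 1 ≤ N := by
        exact_mod_cast Int.ceil_le.1 hN
      linarith
    have h2 := Real.rpow_le_rpow (by positivity) h1 hα.le
    rw [← Real.rpow_mul hr, one_div_mul_cancel hα.ne', Real.rpow_one] at h2
    gcongr
  · intro ψ φ hψ hP l ε s hl hε _ hs f hf hf0 N hN
    refine ModuleSequence.capturesEnergy_of_layerRatio_le (l := l) hψ.filtersMemL1L2 hP hψ.demodulates
      (by rw [Module.finrank_self]; push_cast; linarith) hε hs one_pos hf hf0 ?_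
    gcongr
    exact le_pow_of_ceil_logb_le (by norm_num)
      (layerRatio_nonneg (by linarith) hε.le zero_le_one f) hN
  · intro R hR g φ hg hP l ε s hl hε _ hs f hf hf0 N hN
    refine ModuleSequence.capturesEnergy_of_layerRatio_le (l := l) hg.filtersMemL1L2 hP
      (hg.demodulates hR) (by rw [Module.finrank_self]; push_cast; linarith) hε hs hR hf hf0 ?_
    gcongr
    exact le_pow_of_ceil_logb_le (by norm_num)
      (layerRatio_nonneg (by linarith) hε.le hR.le f) hN
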